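/- Let $d\ge 2$, let $\Omega\subset\mathbb{R}^d$ be open, and let $1<p\le q<\infty$. Let $\varphi:\Omega\times[0,\infty)\to[0,\infty)$ be a generalized convex $\Phi$-function that is $C^1$ in its second variable: $x\mapsto\varphi(x,|f(x)|)$ is measurable for every measurable $f:\Omega\to\mathbb{R}$, and for every $x\in\Omega$ the function $\varphi(x,\cdot)\in C^1([0,\infty))$ is nondecreasing and convex with $\varphi(x,0)=0$ and $\varphi(x,t)\to\infty$ as $t\to\infty$. Write $\varphi_t$ for its derivative in the second variable and assume: - there is $L\ge 1$ with $1/L\le\varphi_t(x,1)\le L$ for all $x\in\Omega$; - for every $x\in\Omega$, on $(0,\infty)$ the function $t\mapsto\varphi_t(x,t)/t^{p-1}$ is nondecreasing and $t\mapsto\varphi_t(x,t)/t^{q-1}$ is nonincreasing; - (VA1) there is a nondecreasing continuous $\omega:[0,\infty)\to[0,1]$ with $\omega(0)=0$ such that, for every ball $B_r(x_0)\subset\Omega$ and every $t>0$, writing $\varphi^-(t)=\inf_{x\in B_r(x_0)}\varphi(x,t)$ and $\varphi^+(t)=\sup_{x\in B_r(x_0)}\varphi(x,t)$, one has $\varphi^+(t)\le(1+\omega(r))\,\varphi^-(t)$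 whenever $\omega(r)\le\varphi^-(t)\le 1/\mathcal{L}^d(B_r(x_0))$. Let $R>0$ be such that $\overline{B_{2R}(0)}\subset\Omega$, and let $(r_j)_{j\in\mathbb N}$, $(\sigma_j)_{j\in\mathbb N}$ be sequences of nonnegative numbers with $Rr_j<1$ for every $j$, $r_j\to0$, $\sigma_j\to\infty$ and $\varphi(0,\sigma_j)\,r_j\to0$. Set $$\varphi_j(x,t):=\frac{\varphi(r_jx,\sigma_jt)}{\varphi(0,\sigma_j)},\qquad x\in B_{2R}(0),\ t\ge0$$ (for the finitely many $j$ for which this is not defined, $\varphi_j$ may be chosen arbitrarily), and let $\varphi_\infty$ be a function on $[0,\infty)$ such that $\varphi_j(x,t)\to\varphi_\infty(t)$ uniformly on $B_{2R}(0)\times K$ for every compact $K\subset[0,\infty)$. Let $(v_j)_{j\in\mathbb N}\subset W^{1,1}(B_R(0))$ satisfy, for some $C<\infty$, $$\sup_{j\in\mathbb{N}}\int_{B_R(0)}\varphi_j(y,|\nabla v_j|)\,dy\le C,$$ and suppose that $v_j\to v_0$ a.e. in $B_R(0)$ for some function $v_0:B_R(0)\to\mathbb{R}$. Then $v_0\in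 W^{1,1}(B_R(0))$ and $$\int_{B_R(0)}\varphi_\infty(|\nabla v_0|)\,dy\le\liminf_{j\to\infty}\int_{B_R(0)}\varphi_j(y,|\nabla v_j|)\,dy.$$ -/

import Mathlib

open Set Filter Topology MeasureTheory
open scoped ENNReal ContDiff

noncomputable section

namespace GenOrlicz

/-- A finite-valued convex Φ-function; only the values on `[0, ∞)` matter. -/
structure IsConvexPhi (ψ : ℝ → ℝ) : Prop where
  monotoneOn : MonotoneOn ψ (Ici 0)
  map_zero : ψ 0 = 0
  tendsto_zero : Tendsto ψ (𝓝[>] 0) (𝓝 0)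
  tendsto_atTop : Tendsto ψ atTop atTop
  leftContinuous : ∀ t, 0 < t → ContinuousWithinAt ψ (Iic t) t
  convexOn : ConvexOn ℝ (Ici 0) ψ

variable {d : ℕ}

/-- A finite-valued generalized convex Φ-function on `Ω`. A Lebesgue measurable function on `Ω` is
one that is a.e. measurable for Lebesgue measure restricted to `Ω`. -/
structure IsGenConvexPhi (Ω : Set (EuclideanSpace ℝ (Fin d)))
    (φ : EuclideanSpace ℝ (Fin d) → ℝ → ℝ) : Prop where
  measurable : ∀ f : EuclideanSpace ℝ (Fin d) → ℝ, AEMeasurable f (volume.restrict Ω) →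
    AEMeasurable (fun x => φ x |f x|) (volume.restrict Ω)
  isConvexPhi : ∀ x ∈ Ω, IsConvexPhi (φ x)

/-- `φ(x, ·) ∈ C¹([0, ∞))` for every `x ∈ Ω`. -/
def IsC1 (Ω : Set (EuclideanSpace ℝ (Fin d))) (φ : EuclideanSpace ℝ (Fin d) → ℝ → ℝ) : Prop :=
  ∀ x ∈ Ω, ContDiffOn ℝ 1 (φ x) (Ici 0)

/-- The right derivative `φ_t(x, t)` in the second variable. -/
def rightDeriv (φ : EuclideanSpace ℝ (Fin d) → ℝ → ℝ) :
    EuclideanSpace ℝ (Fin d) → ℝ → ℝ :=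
  fun x t => derivWithin (φ x) (Ioi t) t

/-- (inc)_p: `t ↦ φ(x, t) / t ^ p` is nondecreasing on `(0, ∞)`. -/
def Inc (Ω : Set (EuclideanSpace ℝ (Fin d))) (p : ℝ)
    (φ : EuclideanSpace ℝ (Fin d) → ℝ → ℝ) : Prop :=
  ∀ x ∈ Ω, MonotoneOn (fun t : ℝ => φ x t / t ^ p) (Ioi 0)

/-- (dec)_q: `t ↦ φ(x, t) / t ^ q` is nonincreasing on `(0, ∞)`. -/
def Dec (Ω : Set (EuclideanSpace ℝ (Fin d))) (q : ℝ)
    (φ : EuclideanSpace ℝ (Fin d) → ℝ → ℝ) : Prop :=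
  ∀ x ∈ Ω, AntitoneOn (fun t : ℝ => φ x t / t ^ q) (Ioi 0)

/-- (A0). -/
def A0 (Ω : Set (EuclideanSpace ℝ (Fin d))) (φ : EuclideanSpace ℝ (Fin d) → ℝ → ℝ) : Prop :=
  ∃ L : ℝ, 1 ≤ L ∧ ∀ x ∈ Ω, 1 / L ≤ φ x 1 ∧ φ x 1 ≤ L

/-- `φ⁻(t) = inf` of `φ(x, t)` over `x ∈ B`, in `[0, ∞]`. -/
def lowerEnv (φ : EuclideanSpace ℝ (Fin d) → ℝ → ℝ) (B : Set (EuclideanSpace ℝ (Fin d)))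
    (t : ℝ) : ℝ≥0∞ :=
  ⨅ x ∈ B, ENNReal.ofReal (φ x t)

/-- `φ⁺(t) = sup` of `φ(x, t)` over `x ∈ B`, in `[0, ∞]`. -/
def upperEnv (φ : EuclideanSpace ℝ (Fin d) → ℝ → ℝ) (B : Set (EuclideanSpace ℝ (Fin d)))
    (t : ℝ) : ℝ≥0∞ :=
  ⨆ x ∈ B, ENNReal.ofReal (φ x t)

/-- (VA1), with modulus `w`. -/
def VA1 (Ω : Set (EuclideanSpace ℝ (Fin d))) (φ : EuclideanSpace ℝ (Fin d) → ℝ → ℝ) : Prop :=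
  ∃ w : ℝ → ℝ, MonotoneOn w (Ici 0) ∧ ContinuousOn w (Ici 0) ∧ MapsTo w (Ici 0) (Icc 0 1) ∧
    w 0 = 0 ∧
    ∀ (x₀ : EuclideanSpace ℝ (Fin d)) (r : ℝ), 0 < r → Metric.ball x₀ r ⊆ Ω →
      ∀ t : ℝ, 0 < t →
        lowerEnv φ (Metric.ball x₀ r) t ∈
          Icc (ENNReal.ofReal (w r)) (1 / volume (Metric.ball x₀ r)) →
        upperEnv φ (Metric.ball x₀ r) t ≤
          ENNReal.ofReal (1 + w r) * lowerEnv φ (Metric.ball x₀ r) t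

/-- The rescaled integrand `φ(r x, σ t) / φ(0, σ)`. -/
def rescale (φ : EuclideanSpace ℝ (Fin d) → ℝ → ℝ) (r σ : ℝ) :
    EuclideanSpace ℝ (Fin d) → ℝ → ℝ :=
  fun x t => φ (r • x) (σ * t) / φ 0 σ

/-- `v ∈ W^{1,1}(U)` with weak gradient `g` (which is unique up to null sets of `U`). -/
structure IsW11Gradient (U : Set (EuclideanSpace ℝ (Fin d))) (v : EuclideanSpace ℝ (Fin d) → ℝ)
    (g : EuclideanSpace ℝ (Fin d) → EuclideanSpace ℝ (Fin d)) : Prop where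
  integrableOn : IntegrableOn v U
  integrableOn_grad : IntegrableOn g U
  integral_eq : ∀ η : EuclideanSpace ℝ (Fin d) → ℝ, ContDiff ℝ ∞ η → HasCompactSupport η →
    tsupport η ⊆ U → ∀ i : Fin d,
      ∫ x in U, v x * fderiv ℝ η x (EuclideanSpace.single i 1) = - ∫ x in U, g x i * η x

end GenOrlicz

end

/-! The proof is the direct method: a uniform superlinear lower bound on the integrands gives weak
compactness of the gradients, and convexity of the limit integrand gives lower semicontinuity.

Growth. Since `φ_t / t ^ (p - 1)` is nondecreasing, `φ(x, l s) ≥ l ^ p φ(x, s)` for `l ≥ 1`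
(`rpow_mul_le_of_monotoneOn`). By normalization `φ_j(0, 1) = 1` for large `j`, so `φ_∞(1) = 1`, and
uniform convergence gives `φ_j(y, 1) ≥ 1/2`. Hence `φ_j(y, t) ≥ t ^ p / 2` for `t ≥ 1` and large
`j`, and the energy bound becomes a bound for the gradients in `L^p` with `p > 1`.

Compactness. The functions themselves carry no a priori bound. Almost everywhere convergence bounds
all `v_j` by one constant on a set of positive measure, which fixes the additive constant left free
by the Poincaré inequality. The resulting `L^p` bound and Vitali's theorem give `v_j → v₀` in `L¹`
(`tendsto_L1_of_gradient_bound`). The gradients are equiintegrable, hence converge weakly in `L¹`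
along every ultrafilter finer than `atTop`, and the limit is the weak gradient of `v₀`
(`exists_weak_limit_gradient`). Ultrafilters take the place of subsequences.

Lower semicontinuity. The limit `φ_∞` is convex and nondecreasing. For slopes taken at points of
`[0, k]`, its supporting lines lie below `φ_j(y, ·) + ε` on all of `[0, ∞)`: by uniform convergence
on a compact interval and by superlinear growth beyond it (`eventually_tangent_le`). Inserting the
supporting line at `|∇v₀|` makes the gradients enter only through a pairing with a bounded field,
which passes to the weak limit (`lintegral_le_of_weak_limit`); then `ε → 0` and `k → ∞`. -/

namespace GenOrlicz

/-! ### Weak compactness in `L¹` of equiintegrable families. -/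

section WeakCompactness

/-- A bounded family in a real Hilbert space converges weakly along every ultrafilter. -/
theorem exists_weak_limit_of_norm_le {ι H : Type*} [NormedAddCommGroup H] [InnerProductSpace ℝ H]
    [CompleteSpace H] (U : Ultrafilter ι) (x : ι → H) (C : ℝ) (hx : ∀ j, ‖x j‖ ≤ C) :
    ∃ x₀ : H, ∀ h : H, Tendsto (fun j => inner ℝ (x j) h) U (𝓝 (inner ℝ x₀ h)) := by
  -- Riesz representation moves the family into the dual, where Banach–Alaoglu makes closed balls
  -- weak-* compact.
  let T : ι → WeakDual ℝ H := fun j => StrongDual.toWeakDual (InnerProductSpace.toDual ℝ H (x j))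
  have hT : (WeakDual.toStrongDual ⁻¹' Metric.closedBall (0 : StrongDual ℝ H) C) ∈ U.map T := by
    refine Ultrafilter.mem_map.2 (Filter.univ_mem' fun j => ?_)
    simp only [mem_preimage, T, mem_closedBall_zero_iff]
    exact (LinearIsometryEquiv.norm_map (InnerProductSpace.toDual ℝ H) (x j)).trans_le (hx j)
  obtain ⟨l, -, hl⟩ :=
    (WeakDual.isCompact_closedBall (𝕜 := ℝ) (0 : StrongDual ℝ H) C).ultrafilter_le_nhds' _ hT
  refine ⟨(InnerProductSpace.toDual ℝ H).symm (WeakDual.toStrongDual l), fun h => ?_⟩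
  have h1 : Tendsto T U (𝓝 l) := hl
  have h2 := ((WeakDual.eval_continuous h).tendsto l).comp h1
  rw [InnerProductSpace.toDual_symm_apply]
  exact h2

/-- Truncation at height `k`: vectors of norm larger than `k` are replaced by zero. -/
noncomputable def trunc {E : Type*} [NormedAddCommGroup E] (k : ℕ) : E → E :=
  (Metric.closedBall 0 (k : ℝ)).indicator id

section trunc

variable {E : Type*} [NormedAddCommGroup E]

lemma norm_trunc_le (k : ℕ) (ξ : E) : ‖trunc k ξ‖ ≤ k := by
  by_cases h : ξ ∈ Metric.closedBall (0 : E) (k : ℝ)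
  · have h' : ‖ξ‖ ≤ k := by simpa using h
    simpa only [trunc, indicator_of_mem h, id] using h'
  · simp [trunc, h]

lemma norm_sub_trunc_le (k : ℕ) (ξ : E) : ‖ξ - trunc k ξ‖ ≤ ‖ξ‖ := by
  by_cases h : ξ ∈ Metric.closedBall (0 : E) (k : ℝ) <;> simp [trunc, h]

/-- Lets a tail estimate at one height serve at all larger heights. -/
lemma norm_sub_trunc_anti {k l : ℕ} (hkl : k ≤ l) (ξ : E) :
    ‖ξ - trunc l ξ‖ ≤ ‖ξ - trunc k ξ‖ := by
  by_cases h : ξ ∈ Metric.closedBall (0 : E) (k : ℝ)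
  · have h' : ξ ∈ Metric.closedBall (0 : E) (l : ℝ) :=
      Metric.closedBall_subset_closedBall (by exact_mod_cast hkl) h
    simp [trunc, h, h']
  · simpa [trunc, h] using norm_sub_trunc_le l ξ

lemma measurable_trunc [MeasurableSpace E] [BorelSpace E] (k : ℕ) :
    Measurable (trunc k : E → E) :=
  measurable_id.indicator measurableSet_closedBall

/-- The part of a vector above the truncation height is controlled by its `p`-th power. -/
lemma norm_sub_trunc_le_rpow {p : ℝ} (hp : 1 < p) {k : ℕ} (hk : 0 < k) (ξ : E) :
    ‖ξ - trunc k ξ‖ ≤ (k : ℝ) ^ (1 - p) * ‖ξ‖ ^ p := by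
  have hk' : (0 : ℝ) < k := by exact_mod_cast hk
  by_cases h : ξ ∈ Metric.closedBall (0 : E) (k : ℝ)
  · simp only [trunc, h, indicator_of_mem, id, sub_self, norm_zero]
    positivity
  · have h' : (k : ℝ) < ‖ξ‖ := by simpa using h
    simp only [trunc, h, not_false_eq_true, indicator_of_notMem, sub_zero]
    have h1 : ‖ξ‖ ^ (1 - p) ≤ (k : ℝ) ^ (1 - p) :=
      Real.rpow_le_rpow_of_nonpos hk' h'.le (by linarith)
    calc ‖ξ‖ = ‖ξ‖ ^ (1 - p) * ‖ξ‖ ^ p := by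
          rw [← Real.rpow_add (hk'.trans h')]; simp
      _ ≤ _ := by gcongr

end trunc

variable {ι α E : Type*} [MeasurableSpace α] {μ : Measure α}
  [NormedAddCommGroup E] [InnerProductSpace ℝ E]

lemma integrable_inner_of_norm_le {f η : α → E} (hf : Integrable f μ)
    (hη : AEStronglyMeasurable η μ) {K : ℝ} (hK : ∀ x, ‖η x‖ ≤ K) :
    Integrable (fun x => inner ℝ (f x) (η x)) μ := by
  refine (hf.norm.mul_const K).mono' (hf.1.inner hη) (ae_of_all _ fun x => ?_)
  exact (norm_inner_le_norm _ _).trans (by gcongr; exact hK x)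

lemma abs_integral_inner_le {f η : α → E} (hf : Integrable f μ)
    {K : ℝ} (hK : ∀ x, ‖η x‖ ≤ K) :
    |∫ x, inner ℝ (f x) (η x) ∂μ| ≤ K * ∫ x, ‖f x‖ ∂μ := by
  rw [← Real.norm_eq_abs, ← integral_const_mul]
  refine norm_integral_le_of_norm_le (hf.norm.const_mul K) (ae_of_all _ fun x => ?_)
  refine (norm_inner_le_norm _ _).trans ?_
  rw [mul_comm]
  gcongr
  exact hK x

variable [IsFiniteMeasure μ] [CompleteSpace E]

/-- A uniformly bounded family of functions converges weakly along every ultrafilter. -/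
theorem exists_weak_limit_of_uniformly_bounded (U : Ultrafilter ι) (f : ι → α → E)
    (hf : ∀ j, AEStronglyMeasurable (f j) μ) (K : ℝ) (hK : ∀ j x, ‖f j x‖ ≤ K) :
    ∃ g : α → E, Integrable g μ ∧ ∀ η : α → E, AEStronglyMeasurable η μ →
      (∃ K, ∀ x, ‖η x‖ ≤ K) →
      Tendsto (fun j => ∫ x, inner ℝ (f j x) (η x) ∂μ) U (𝓝 (∫ x, inner ℝ (g x) (η x) ∂μ)) := by
  -- On a finite measure space uniform bounds give `L²` bounds, so the Hilbert space result applies.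
  have hm : ∀ j, MemLp (f j) 2 μ := fun j => MemLp.of_bound (hf j) K (ae_of_all _ (hK j))
  obtain ⟨C, hC⟩ : ∃ C : ℝ, ∀ j, ‖(hm j).toLp (f j)‖ ≤ C := by
    refine ⟨measureUnivNNReal μ ^ ((2 : ℝ≥0∞).toReal)⁻¹ * max K 0, fun j => ?_⟩
    refine Lp.norm_le_of_ae_bound (le_max_right _ _) ?_
    filter_upwards [(hm j).coeFn_toLp] with x hx
    rw [hx]
    exact (hK j x).trans (le_max_left _ _)
  obtain ⟨G, hG⟩ := exists_weak_limit_of_norm_le U (fun j => (hm j).toLp (f j)) C hC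
  refine ⟨G, (Lp.memLp G).integrable (by norm_num), fun η hη ⟨L, hL⟩ => ?_⟩
  have hη2 : MemLp η 2 μ := MemLp.of_bound hη L (ae_of_all _ hL)
  have := hG (hη2.toLp η)
  simp only [L2.inner_def] at this
  refine (this.congr fun j => ?_).trans_eq ?_
  · refine integral_congr_ae ?_
    filter_upwards [(hm j).coeFn_toLp, hη2.coeFn_toLp] with x h1 h2
    rw [h1, h2]
  · congr 1
    refine integral_congr_ae ?_
    filter_upwards [hη2.coeFn_toLp] with x h2
    rw [h2]

/-- An equiintegrable family of functions on a finite measure space converges weakly in `L¹` along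
every ultrafilter. -/
theorem exists_weak_limit_of_equiintegrable [MeasurableSpace E] [BorelSpace E]
    [SecondCountableTopology E] (U : Ultrafilter ι) (f : ι → α → E)
    (hf : ∀ j, Integrable (f j) μ)
    (hui : ∀ ε > 0, ∃ k : ℕ, ∀ᶠ j in U, ∫ x, ‖f j x - trunc k (f j x)‖ ∂μ ≤ ε) :
    ∃ g : α → E, Integrable g μ ∧ ∀ η : α → E, AEStronglyMeasurable η μ →
      (∃ K, ∀ x, ‖η x‖ ≤ K) →
      Tendsto (fun j => ∫ x, inner ℝ (f j x) (η x) ∂μ) U (𝓝 (∫ x, inner ℝ (g x) (η x) ∂μ)) := by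
  have hmeas : ∀ k j, AEStronglyMeasurable (fun x => trunc k (f j x)) μ := fun k j =>
    ((measurable_trunc k).comp_aemeasurable (hf j).1.aemeasurable).aestronglyMeasurable
  have hint : ∀ k j, Integrable (fun x => trunc k (f j x)) μ := fun k j =>
    Integrable.of_bound (hmeas k j) k (ae_of_all _ fun x => norm_trunc_le k _)
  have htail : ∀ k j, Integrable (fun x => f j x - trunc k (f j x)) μ := fun k j =>
    (hf j).sub (hint k j)
  -- The truncations at each height `k` have a weak limit `g k`; uniformly small tails make these
  -- limits Cauchy in `L¹`, and their `L¹` limit is the weak limit sought.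
  choose g hg hlim using fun k => exists_weak_limit_of_uniformly_bounded U
    (fun j x => trunc k (f j x)) (hmeas k) k (fun j x => norm_trunc_le k _)
  have hcauchy : ∀ ε > 0, ∃ N : ℕ, ∀ k ≥ N, ∀ l ≥ N, ∫ x, ‖g k x - g l x‖ ∂μ ≤ 2 * ε ∧
      ∀ᶠ j in U, ∫ x, ‖f j x - trunc k (f j x)‖ ∂μ ≤ ε := by
    intro ε hε
    obtain ⟨N, hN⟩ := hui ε hε
    have hN' : ∀ k ≥ N, ∀ᶠ j in U, ∫ x, ‖f j x - trunc k (f j x)‖ ∂μ ≤ ε := fun k hk => by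
      filter_upwards [hN] with j hj
      exact (integral_mono (htail k j).norm (htail N j).norm
        fun x => norm_sub_trunc_anti hk _).trans hj
    refine ⟨N, fun k hk l hl => ⟨?_, hN' k hk⟩⟩
    -- The unit field in the direction of `g k - g l` (zero where they agree) turns the pairing into
    -- the `L¹` distance.
    let η : α → E := fun x => ‖g k x - g l x‖⁻¹ • (g k x - g l x)
    have hη1 : ∀ x, ‖η x‖ ≤ 1 := fun x => by
      simp only [η, norm_smul, norm_inv, norm_norm]
      exact inv_mul_le_one
    have hηm : AEStronglyMeasurable η μ := by
      have h := ((hg k).sub (hg l)).1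
      exact (h.norm.aemeasurable.inv.aestronglyMeasurable).smul h
    have h1 := (hlim k η hηm ⟨1, hη1⟩).sub (hlim l η hηm ⟨1, hη1⟩)
    have h2 : ∫ x, inner ℝ (g k x) (η x) ∂μ - ∫ x, inner ℝ (g l x) (η x) ∂μ
        = ∫ x, ‖g k x - g l x‖ ∂μ := by
      rw [← integral_sub (integrable_inner_of_norm_le (hg k) hηm hη1)
        (integrable_inner_of_norm_le (hg l) hηm hη1)]
      congr 1 with x
      rw [← inner_sub_left, inner_smul_right, real_inner_self_eq_norm_sq]
      by_cases h0 : ‖g k x - g l x‖ = 0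
      · simp [h0]
      · field_simp
    rw [h2] at h1
    refine le_of_tendsto h1 ?_
    filter_upwards [hN' k hk, hN' l hl] with j hjk hjl
    rw [← integral_sub (integrable_inner_of_norm_le (hint k j) hηm hη1)
        (integrable_inner_of_norm_le (hint l j) hηm hη1)]
    simp_rw [← inner_sub_left]
    refine (le_abs_self _).trans ((abs_integral_inner_le ((hint k j).sub (hint l j)) hη1).trans ?_)
    rw [one_mul]
    calc ∫ x, ‖trunc k (f j x) - trunc l (f j x)‖ ∂μ
        ≤ ∫ x, (‖f j x - trunc k (f j x)‖ + ‖f j x - trunc l (f j x)‖) ∂μ := by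
          refine integral_mono ((hint k j).sub (hint l j)).norm
            ((htail k j).norm.add (htail l j).norm) fun x => ?_
          simpa [norm_sub_rev] using
            norm_sub_le_norm_sub_add_norm_sub (trunc k (f j x)) (f j x) (trunc l (f j x))
      _ ≤ 2 * ε := by
          rw [integral_add (htail k j).norm (htail l j).norm]; linarith
  have hdist : ∀ k l, dist ((hg k).toL1 (g k)) ((hg l).toL1 (g l)) = ∫ x, ‖g k x - g l x‖ ∂μ := by
    intro k l
    rw [L1.dist_eq_integral_dist]
    refine integral_congr_ae ?_
    filter_upwards [(hg k).coeFn_toL1, (hg l).coeFn_toL1] with x h1 h2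
    rw [h1, h2, dist_eq_norm]
  have hcs : CauchySeq (fun k => (hg k).toL1 (g k)) := by
    refine Metric.cauchySeq_iff.2 fun ε hε => ?_
    obtain ⟨N, hN⟩ := hcauchy (ε / 4) (by positivity)
    refine ⟨N, fun k hk l hl => ?_⟩
    rw [hdist]
    exact (hN k hk l hl).1.trans_lt (by linarith)
  obtain ⟨G, hG⟩ := cauchySeq_tendsto_of_complete hcs
  have hGi : Integrable G μ := L1.integrable_coeFn G
  have hG' : Tendsto (fun k => ∫ x, ‖g k x - G x‖ ∂μ) atTop (𝓝 0) := by
    refine (tendsto_iff_dist_tendsto_zero.1 hG).congr fun k => ?_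
    rw [L1.dist_eq_integral_dist]
    refine integral_congr_ae ?_
    filter_upwards [(hg k).coeFn_toL1] with x h1
    rw [h1, dist_eq_norm]
  refine ⟨G, hGi, fun η hη ⟨K, hK⟩ => Metric.tendsto_nhds.2 fun ε hε => ?_⟩
  have hK0 : 0 < max K 1 := lt_max_of_lt_right one_pos
  have hK' : ∀ x, ‖η x‖ ≤ max K 1 := fun x => (hK x).trans (le_max_left _ _)
  obtain ⟨N, hN⟩ := hcauchy (ε / (4 * max K 1)) (by positivity)
  obtain ⟨k, hkN, hk⟩ := ((eventually_ge_atTop N).and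
    (hG'.eventually_lt_const (show 0 < ε / (4 * max K 1) by positivity))).exists
  filter_upwards [(hN k hkN k hkN).2,
    (Metric.tendsto_nhds.1 (hlim k η hη ⟨K, hK⟩)) (ε / 4) (by positivity)] with j h1 h2
  have e1 : |∫ x, inner ℝ (f j x) (η x) ∂μ - ∫ x, inner ℝ (trunc k (f j x)) (η x) ∂μ| ≤ ε / 4 := by
    rw [← integral_sub (integrable_inner_of_norm_le (hf j) hη hK)
      (integrable_inner_of_norm_le (hint k j) hη hK)]
    simp_rw [← inner_sub_left]
    refine (abs_integral_inner_le (htail k j) hK').trans ?_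
    calc _ ≤ max K 1 * (ε / (4 * max K 1)) := by gcongr
      _ = ε / 4 := by field_simp
  have e2 : |∫ x, inner ℝ (g k x) (η x) ∂μ - ∫ x, inner ℝ (G x) (η x) ∂μ| ≤ ε / 4 := by
    rw [← integral_sub (integrable_inner_of_norm_le (hg k) hη hK)
      (integrable_inner_of_norm_le hGi hη hK)]
    simp_rw [← inner_sub_left]
    refine (abs_integral_inner_le ((hg k).sub hGi) hK').trans ?_
    calc _ ≤ max K 1 * (ε / (4 * max K 1)) := by gcongr; exact hk.le
      _ = ε / 4 := by field_simp
  rw [Real.dist_eq] at h2 ⊢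
  rw [abs_le] at e1 e2
  rw [abs_lt] at h2 ⊢
  constructor <;> linarith [e1.1, e1.2, e2.1, e2.2, h2.1, h2.2]

end WeakCompactness

/-! ### The Poincaré inequality for `C¹` functions. -/

section Poincare

/-- Jensen's inequality for powers. -/
lemma rpow_lintegral_le {α : Type*} [MeasurableSpace α] {ν : Measure α} [IsProbabilityMeasure ν]
    {p : ℝ} (hp : 1 < p) {f : α → ℝ≥0∞} (hf : AEMeasurable f ν) :
    (∫⁻ x, f x ∂ν) ^ p ≤ ∫⁻ x, f x ^ p ∂ν := by
  have h := ENNReal.lintegral_mul_le_Lp_mul_Lq ν (Real.HolderConjugate.conjExponent hp) hf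
    (aemeasurable_const (b := (1 : ℝ≥0∞)))
  simp only [Pi.mul_apply, mul_one, ENNReal.one_rpow, lintegral_const, measure_univ] at h
  calc _ ≤ ((∫⁻ x, f x ^ p ∂ν) ^ (1 / p)) ^ p := by gcongr
    _ = _ := by rw [← ENNReal.rpow_mul, one_div_mul_cancel (by linarith), ENNReal.rpow_one]

section Smooth

variable {E : Type*} [NormedAddCommGroup E] [NormedSpace ℝ E]

/-- The increment of a `C¹` function along a segment. -/
lemma enorm_sub_rpow_le_lintegral_segment {u : E → ℝ} (hu : ContDiff ℝ 1 u) {p : ℝ} (hp : 1 < p)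
    (x y : E) :
    ‖u x - u y‖ₑ ^ p ≤
      ‖y - x‖ₑ ^ p * ∫⁻ t in Ioc (0 : ℝ) 1, ‖fderiv ℝ u (x + t • (y - x))‖ₑ ^ p := by
  have hc : Continuous fun t : ℝ => fderiv ℝ u (x + t • (y - x)) :=
    (hu.continuous_fderiv one_ne_zero).comp (by fun_prop)
  have hd : ∀ t : ℝ, HasDerivAt (fun t : ℝ => u (x + t • (y - x)))
      (fderiv ℝ u (x + t • (y - x)) (y - x)) t := fun t => by
    have h1 : HasDerivAt (fun t : ℝ => x + t • (y - x)) (y - x) t := by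
      simpa using ((hasDerivAt_id t).smul_const (y - x)).const_add x
    exact ((hu.differentiable one_ne_zero) _).hasFDerivAt.comp_hasDerivAt t h1
  have hi := intervalIntegral.integral_eq_sub_of_hasDerivAt (a := 0) (b := 1) (fun t _ => hd t)
    ((hc.clm_apply continuous_const).intervalIntegrable _ _)
  rw [intervalIntegral.integral_of_le zero_le_one] at hi
  simp only [one_smul, add_sub_cancel, zero_smul, add_zero] at hi
  have h1 : ‖u x - u y‖ₑ ≤ ‖y - x‖ₑ * ∫⁻ t in Ioc (0 : ℝ) 1, ‖fderiv ℝ u (x + t • (y - x))‖ₑ := by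
    rw [← enorm_neg, neg_sub, ← hi, mul_comm, ← lintegral_mul_const' _ _ enorm_ne_top]
    refine (enorm_integral_le_lintegral_enorm _).trans (lintegral_mono fun t => ?_)
    exact ContinuousLinearMap.le_opENorm _ _
  have : IsProbabilityMeasure (volume.restrict (Ioc (0 : ℝ) 1)) := ⟨by simp⟩
  calc _ ≤ (‖y - x‖ₑ * ∫⁻ t in Ioc (0 : ℝ) 1, ‖fderiv ℝ u (x + t • (y - x))‖ₑ) ^ p := by gcongr
    _ = ‖y - x‖ₑ ^ p * (∫⁻ t in Ioc (0 : ℝ) 1, ‖fderiv ℝ u (x + t • (y - x))‖ₑ) ^ p :=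
      ENNReal.mul_rpow_of_nonneg _ _ (by linarith)
    _ ≤ _ := by
      gcongr
      exact rpow_lintegral_le hp hc.enorm.measurable.aemeasurable

variable [MeasurableSpace E] [BorelSpace E] [FiniteDimensional ℝ E] (μ : Measure E)
  [μ.IsAddHaarMeasure]

/-- Translation preserves the measure, and dilation by `t` costs the factor `t⁻¹` to the power of
the dimension, at most a power of `2`. -/
lemma lintegral_comp_add_smul_le {F : E → ℝ≥0∞} (hF : Measurable F) (a : E) {t : ℝ}
    (ht : 1 / 2 ≤ t) :
    ∫⁻ y, F (a + t • y) ∂μ ≤ 2 ^ Module.finrank ℝ E * ∫⁻ y, F y ∂μ := by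
  have ht0 : 0 < t := by linarith
  have h1 : ∫⁻ y, F (a + t • y) ∂μ = ∫⁻ z, F (a + z) ∂(Measure.map (t • ·) μ) :=
    (lintegral_map (hF.comp (measurable_const_add a)) (measurable_const_smul t)).symm
  rw [h1, Measure.map_addHaar_smul μ ht0.ne', lintegral_smul_measure, lintegral_add_left_eq_self,
    smul_eq_mul]
  gcongr
  rw [← inv_pow, abs_of_pos (by positivity), ENNReal.ofReal_pow (by positivity)]
  gcongr
  rw [show (2 : ℝ≥0∞) = ENNReal.ofReal 2 by simp]
  refine ENNReal.ofReal_le_ofReal ?_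
  rw [inv_le_comm₀ ht0 two_pos]
  simpa using ht

/-- The Poincaré inequality for `C¹` functions on a bounded convex set, in the form of a double
integral. -/
theorem lintegral_lintegral_enorm_sub_rpow_le {u : E → ℝ} (hu : ContDiff ℝ 1 u) {p : ℝ}
    (hp : 1 < p) {B : Set E} (hB : Convex ℝ B) (hBm : MeasurableSet B) {D : ℝ≥0∞}
    (hD : ∀ x ∈ B, ∀ y ∈ B, ‖y - x‖ₑ ≤ D) :
    ∫⁻ x in B, ∫⁻ y in B, ‖u x - u y‖ₑ ^ p ∂μ ∂μ ≤
      D ^ p * (2 ^ Module.finrank ℝ E * μ B * ∫⁻ x in B, ‖fderiv ℝ u x‖ₑ ^ p ∂μ) := by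
  set F : E → ℝ≥0∞ := B.indicator fun x => ‖fderiv ℝ u x‖ₑ ^ p with hF
  have hFm : Measurable F :=
    ((hu.continuous_fderiv one_ne_zero).enorm.measurable.pow_const p).indicator hBm
  have hFi : ∫⁻ x, F x ∂μ = ∫⁻ x in B, ‖fderiv ℝ u x‖ₑ ^ p ∂μ := lintegral_indicator hBm _
  have hp0 : 0 < p := by linarith
  have h1 : ∀ x ∈ B, ∀ y ∈ B, ‖u x - u y‖ₑ ^ p ≤
      D ^ p * ∫⁻ t in Ioc (0 : ℝ) 1, F ((1 - t) • x + t • y) := fun x hx y hy => by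
    refine (enorm_sub_rpow_le_lintegral_segment hu hp x y).trans ?_
    gcongr ?_ ^ p * ?_
    · exact hD x hx y hy
    · refine setLIntegral_mono' measurableSet_Ioc fun t ht => ?_
      have h2 : x + t • (y - x) = (1 - t) • x + t • y := by module
      have h3 : (1 - t) • x + t • y ∈ B :=
        hB hx hy (by linarith [ht.2]) ht.1.le (by ring)
      rw [h2, hF, indicator_of_mem h3]
  have hm3 : Measurable fun z : (E × E) × ℝ => F ((1 - z.2) • z.1.1 + z.2 • z.1.2) :=
    hFm.comp (by fun_prop : Continuous fun z : (E × E) × ℝ =>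
      (1 - z.2) • z.1.1 + z.2 • z.1.2).measurable
  have hslice : ∀ t ∈ Ioc (0 : ℝ) 1,
      ∫⁻ x in B, ∫⁻ y in B, F ((1 - t) • x + t • y) ∂μ ∂μ ≤
        2 ^ Module.finrank ℝ E * μ B * ∫⁻ x, F x ∂μ := by
    -- The change of variables is made in the point with coefficient at least `1/2`, so the Jacobian
    -- stays bounded; for `t ≤ 1/2` the two points exchange roles.
    have key : ∀ s t : ℝ, 1 / 2 ≤ t → ∫⁻ x in B, ∫⁻ y in B, F (s • x + t • y) ∂μ ∂μ ≤
        2 ^ Module.finrank ℝ E * μ B * ∫⁻ x, F x ∂μ := fun s t ht => by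
      calc _ ≤ ∫⁻ x in B, 2 ^ Module.finrank ℝ E * ∫⁻ y, F y ∂μ ∂μ :=
            lintegral_mono fun x => (setLIntegral_le_lintegral _ _).trans
              (lintegral_comp_add_smul_le μ hFm _ ht)
        _ = _ := by rw [setLIntegral_const]; ring
    intro t ht
    rcases le_total (1 / 2) t with h | h
    · exact key _ _ h
    · have hsw : ∫⁻ x in B, ∫⁻ y in B, F ((1 - t) • x + t • y) ∂μ ∂μ =
          ∫⁻ y in B, ∫⁻ x in B, F (t • y + (1 - t) • x) ∂μ ∂μ := by
        rw [lintegral_lintegral_swap]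
        · simp_rw [add_comm]
        · exact (hFm.comp (by fun_prop : Continuous fun z : E × E =>
            (1 - t) • z.1 + t • z.2).measurable).aemeasurable
      rw [hsw]
      exact key _ _ (by linarith)
  calc ∫⁻ x in B, ∫⁻ y in B, ‖u x - u y‖ₑ ^ p ∂μ ∂μ
      ≤ ∫⁻ x in B, ∫⁻ y in B,
          D ^ p * (∫⁻ t in Ioc (0 : ℝ) 1, F ((1 - t) • x + t • y) ∂volume) ∂μ ∂μ :=
        setLIntegral_mono' hBm fun x hx => setLIntegral_mono' hBm fun y hy => h1 x hx y hy
    _ = D ^ p * ∫⁻ x in B, ∫⁻ y in B,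
          (∫⁻ t in Ioc (0 : ℝ) 1, F ((1 - t) • x + t • y) ∂volume) ∂μ ∂μ := by
        have hmxy : Measurable fun z : E × E =>
            ∫⁻ t in Ioc (0 : ℝ) 1, F ((1 - t) • z.1 + t • z.2) := hm3.lintegral_prod_right
        rw [← lintegral_const_mul _ hmxy.lintegral_prod_right]
        refine lintegral_congr fun x => ?_
        exact lintegral_const_mul _ (hmxy.comp measurable_prodMk_left)
    _ = D ^ p * ∫⁻ t in Ioc (0 : ℝ) 1, ∫⁻ x in B, ∫⁻ y in B, F ((1 - t) • x + t • y) ∂μ ∂μ := by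
        congr 1
        have hxt : Measurable fun z : E × ℝ => ∫⁻ y in B, F ((1 - z.2) • z.1 + z.2 • y) ∂μ := by
          refine Measurable.lintegral_prod_right
            (f := fun (w : E × ℝ) (y : E) => F ((1 - w.2) • w.1 + w.2 • y)) ?_
          exact hFm.comp (by fun_prop : Continuous fun w : (E × ℝ) × E =>
            (1 - w.1.2) • w.1.1 + w.1.2 • w.2).measurable
        rw [lintegral_lintegral_swap (μ := volume.restrict (Ioc (0 : ℝ) 1)) (ν := μ.restrict B)
          (f := fun t x => ∫⁻ y in B, F ((1 - t) • x + t • y) ∂μ)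
          (hxt.comp measurable_swap).aemeasurable]
        refine lintegral_congr fun x => ?_
        exact lintegral_lintegral_swap (hm3.comp (by fun_prop :
          Measurable fun w : E × ℝ => (((x, w.1), w.2) : (E × E) × ℝ))).aemeasurable
    _ ≤ D ^ p * ∫⁻ t in Ioc (0 : ℝ) 1, 2 ^ Module.finrank ℝ E * μ B * ∫⁻ x, F x ∂μ := by
        exact mul_le_mul' le_rfl (setLIntegral_mono' measurableSet_Ioc hslice)
    _ = _ := by rw [setLIntegral_const, hFi]; simp

end Smooth

end Poincare

/-! ### Mollification, and the Poincaré inequality for Sobolev functions. -/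

section Mollification

open Convolution

variable {d : ℕ}

local notation "𝔼" => EuclideanSpace ℝ (Fin d)

/-- The mollification `∫ v(t) ρ(x - t) dt` of a function defined on `B`. -/
noncomputable def mollify (ρ : ContDiffBump (0 : EuclideanSpace ℝ (Fin d)))
    (B : Set (EuclideanSpace ℝ (Fin d))) (v : EuclideanSpace ℝ (Fin d) → ℝ) :
    EuclideanSpace ℝ (Fin d) → ℝ :=
  B.indicator v ⋆[ContinuousLinearMap.mul ℝ ℝ, volume] ρ.normed volume

variable {ρ : ContDiffBump (0 : EuclideanSpace ℝ (Fin d))}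
  {B : Set (EuclideanSpace ℝ (Fin d))} {v : EuclideanSpace ℝ (Fin d) → ℝ}
  {Dv : EuclideanSpace ℝ (Fin d) → EuclideanSpace ℝ (Fin d)}

lemma contDiff_mollify (hB : MeasurableSet B) (hv : IntegrableOn v B) :
    ContDiff ℝ 1 (mollify ρ B v) :=
  ρ.hasCompactSupport_normed.contDiff_convolution_right _
    ((integrable_indicator_iff hB).2 hv).locallyIntegrable ρ.contDiff_normed

/-- This is the order of factors in which almost everywhere convergence of mollifications is
available. -/
lemma mollify_eq (ρ : ContDiffBump (0 : EuclideanSpace ℝ (Fin d)))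
    (B : Set (EuclideanSpace ℝ (Fin d))) (v : EuclideanSpace ℝ (Fin d) → ℝ) :
    mollify ρ B v = ρ.normed volume ⋆[ContinuousLinearMap.lsmul ℝ ℝ, volume] B.indicator v := by
  rw [mollify, ← convolution_flip]
  congr 1
  ext
  simp

/-- On the points whose distance to the complement of `B` exceeds the radius of `ρ`, the derivative
of the mollification is the mollification of the weak gradient. -/
lemma fderiv_mollify_apply (hB : MeasurableSet B) (hv : IsW11Gradient B v Dv)
    {x : EuclideanSpace ℝ (Fin d)} (hx : Metric.closedBall x ρ.rOut ⊆ B)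
    (w : EuclideanSpace ℝ (Fin d)) :
    fderiv ℝ (mollify ρ B v) x w = inner ℝ (∫ t in B, ρ.normed volume (x - t) • Dv t) w := by
  have hloc : LocallyIntegrable (B.indicator v) :=
    ((integrable_indicator_iff hB).2 hv.integrableOn).locallyIntegrable
  have hder : ∀ e, fderiv ℝ (mollify ρ B v) x e =
      ∫ t in B, v t * fderiv ℝ (ρ.normed volume) (x - t) e := fun e => by
    have h := (ρ.hasCompactSupport_normed (μ := volume)).hasFDerivAt_convolution_right
      (ContinuousLinearMap.mul ℝ ℝ) hloc ρ.contDiff_normed x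
    rw [mollify, h.fderiv, convolution_precompR_apply _ hloc
      ((ρ.hasCompactSupport_normed (μ := volume)).fderiv ℝ)
      ((ρ.contDiff_normed (n := 1)).continuous_fderiv one_ne_zero), convolution,
      ← integral_indicator hB]
    congr 1 with t
    by_cases ht : t ∈ B <;> simp [ht]
  -- The reflected bump is the test function. Its reflection produces a minus sign that cancels the
  -- one in the definition of the weak gradient.
  set η : 𝔼 → ℝ := fun t => ρ.normed volume (x - t) with hη
  have hηs : ContDiff ℝ ∞ η := ρ.contDiff_normed.comp (contDiff_const.sub contDiff_id)
  have hts : tsupport η ⊆ Metric.closedBall x ρ.rOut := by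
    refine closure_minimal (fun t ht => ?_) Metric.isClosed_closedBall
    have : x - t ∈ Function.support (ρ.normed volume) := ht
    rw [ρ.support_normed_eq, mem_ball_zero_iff] at this
    rw [Metric.mem_closedBall, dist_comm, dist_eq_norm]
    exact this.le
  have hηc : HasCompactSupport η :=
    HasCompactSupport.of_support_subset_isCompact (isCompact_closedBall x ρ.rOut)
      (subset_closure.trans hts)
  have hηd : ∀ t e, fderiv ℝ η t e = - fderiv ℝ (ρ.normed volume) (x - t) e := fun t e => by
    have h1 : HasFDerivAt (fun t : 𝔼 => x - t) (-ContinuousLinearMap.id ℝ 𝔼) t := by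
      simpa using (hasFDerivAt_id t).const_sub x
    have h2 := (((ρ.contDiff_normed (μ := volume) (n := 1)).differentiable one_ne_zero)
      (x - t)).hasFDerivAt.comp t h1
    rw [show η = ρ.normed volume ∘ fun t => x - t from rfl, h2.fderiv]
    simp
  have hint : IntegrableOn (fun t => η t • Dv t) B := by
    obtain ⟨K, hK⟩ := hηc.exists_bound_of_continuous hηs.continuous
    exact hv.integrableOn_grad.bdd_smul K hηs.continuous.aestronglyMeasurable (ae_of_all _ hK)
  have hcomp : ∀ i, fderiv ℝ (mollify ρ B v) x (EuclideanSpace.single i 1) =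
      (∫ t in B, η t • Dv t) i := fun i => by
    have h1 := hv.integral_eq η hηs hηc (hts.trans hx) i
    simp_rw [hηd, mul_neg, integral_neg] at h1
    rw [hder, neg_inj.1 h1]
    have h2 := ((EuclideanSpace.proj i : 𝔼 →L[ℝ] ℝ)).integral_comp_comm hint
    simp only [EuclideanSpace.coe_proj] at h2
    rw [← h2]
    congr 1 with t
    simp [mul_comm]
  have hw : w = ∑ i, w i • EuclideanSpace.single i (1 : ℝ) := by
    ext k
    simp [Finset.sum_apply, Pi.single_apply]
  rw [PiLp.inner_apply]
  conv_lhs => rw [hw]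
  simp only [map_sum, map_smul, hcomp, smul_eq_mul]
  simp [hη]

/-- By Riesz the operator norm of the derivative is the norm of the averaged gradient, to which the
triangle inequality for integrals applies. -/
lemma enorm_fderiv_mollify_le (hB : MeasurableSet B) (hv : IsW11Gradient B v Dv)
    {x : EuclideanSpace ℝ (Fin d)} (hx : Metric.closedBall x ρ.rOut ⊆ B) :
    ‖fderiv ℝ (mollify ρ B v) x‖ₑ ≤
      ∫⁻ t in B, ENNReal.ofReal (ρ.normed volume (x - t)) * ‖Dv t‖ₑ := by
  have h : fderiv ℝ (mollify ρ B v) x =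
      innerSL ℝ (∫ t in B, ρ.normed volume (x - t) • Dv t) := by
    ext w
    rw [fderiv_mollify_apply hB hv hx w, innerSL_apply_apply]
  rw [h, ← ofReal_norm, innerSL_apply_norm, ofReal_norm]
  refine (enorm_integral_le_lintegral_enorm _).trans (lintegral_mono fun t => ?_)
  simp only [enorm_smul]
  gcongr
  rw [Real.enorm_of_nonneg (ρ.nonneg_normed _)]

/-- With `lintegral_normed_sub_right`, this says that the mollifying kernel is doubly stochastic. -/
lemma lintegral_normed_sub (ρ : ContDiffBump (0 : EuclideanSpace ℝ (Fin d)))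
    (x : EuclideanSpace ℝ (Fin d)) :
    ∫⁻ t, ENNReal.ofReal (ρ.normed volume (x - t)) = 1 := by
  rw [lintegral_sub_left_eq_self (fun t => ENNReal.ofReal (ρ.normed volume t)) x,
    ← ofReal_integral_eq_lintegral_ofReal ρ.integrable_normed (ae_of_all _ ρ.nonneg_normed),
    ρ.integral_normed, ENNReal.ofReal_one]

lemma lintegral_normed_sub_right (ρ : ContDiffBump (0 : EuclideanSpace ℝ (Fin d)))
    (t : EuclideanSpace ℝ (Fin d)) :
    ∫⁻ x, ENNReal.ofReal (ρ.normed volume (x - t)) = 1 := by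
  rw [lintegral_sub_right_eq_self (fun t => ENNReal.ofReal (ρ.normed volume t)) t,
    ← ofReal_integral_eq_lintegral_ofReal ρ.integrable_normed (ae_of_all _ ρ.nonneg_normed),
    ρ.integral_normed, ENNReal.ofReal_one]

/-- Averaging against a doubly stochastic kernel does not increase the `L^p` norm. -/
lemma lintegral_rpow_le_of_le_lintegral_kernel {α : Type*} [MeasurableSpace α] {μ : Measure α}
    [SFinite μ] {k : α → α → ℝ≥0∞} (hkm : Measurable (Function.uncurry k))
    (hk₁ : ∀ x, ∫⁻ t, k x t ∂μ = 1) (hk₂ : ∀ t, ∫⁻ x, k x t ∂μ = 1) {h : α → ℝ≥0∞}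
    (hh : AEMeasurable h μ) {p : ℝ} (hp : 1 < p) {A : Set α} (hA : MeasurableSet A)
    {F : α → ℝ≥0∞} (hF : ∀ x ∈ A, F x ≤ ∫⁻ t, k x t * h t ∂μ) :
    ∫⁻ x in A, F x ^ p ∂μ ≤ ∫⁻ t, h t ^ p ∂μ := by
  have hpt : ∀ x ∈ A, F x ^ p ≤ ∫⁻ t, k x t * h t ^ p ∂μ := by
    intro x hx
    have hkx : Measurable (k x) := hkm.of_uncurry_left
    -- Unit mass in `t` permits Jensen for each `x`; unit mass in `x` is used after exchanging the
    -- integrals.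
    have : IsProbabilityMeasure (μ.withDensity (k x)) :=
      ⟨by rw [withDensity_apply _ MeasurableSet.univ, setLIntegral_univ, hk₁]⟩
    have hh' : AEMeasurable h (μ.withDensity (k x)) :=
      hh.mono_ac (withDensity_absolutelyContinuous _ _)
    have h1 : F x ≤ ∫⁻ t, h t ∂(μ.withDensity (k x)) := by
      rw [lintegral_withDensity_eq_lintegral_mul₀ hkx.aemeasurable hh]
      exact hF x hx
    calc _ ≤ (∫⁻ t, h t ∂(μ.withDensity (k x))) ^ p := by gcongr
      _ ≤ _ := rpow_lintegral_le hp hh'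
      _ = _ := lintegral_withDensity_eq_lintegral_mul₀ hkx.aemeasurable (hh.pow_const p)
  calc _ ≤ ∫⁻ x in A, ∫⁻ t, k x t * h t ^ p ∂μ ∂μ := setLIntegral_mono' hA hpt
    _ ≤ ∫⁻ x, ∫⁻ t, k x t * h t ^ p ∂μ ∂μ := setLIntegral_le_lintegral _ _
    _ = ∫⁻ t, ∫⁻ x, k x t * h t ^ p ∂μ ∂μ := lintegral_lintegral_swap
        (hkm.aemeasurable.mul (hh.pow_const p).comp_snd)
    _ = ∫⁻ t, h t ^ p ∂μ := by
        refine lintegral_congr fun t => ?_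
        rw [lintegral_mul_const _ hkm.of_uncurry_right, hk₂, one_mul]

/-- Mollification does not increase the `L^p` norm of the gradient. -/
lemma lintegral_enorm_fderiv_mollify_rpow_le (hB : MeasurableSet B) (hv : IsW11Gradient B v Dv)
    {p : ℝ} (hp : 1 < p) {A : Set (EuclideanSpace ℝ (Fin d))} (hA : MeasurableSet A)
    (hAB : ∀ x ∈ A, Metric.closedBall x ρ.rOut ⊆ B) :
    ∫⁻ x in A, ‖fderiv ℝ (mollify ρ B v) x‖ₑ ^ p ≤ ∫⁻ t in B, ‖Dv t‖ₑ ^ p := by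
  have hcont : Continuous fun z : 𝔼 × 𝔼 => ρ.normed volume (z.1 - z.2) :=
    (ρ.contDiff_normed (n := 0)).continuous.comp (continuous_fst.sub continuous_snd)
  have hhm : AEMeasurable (B.indicator fun t => ‖Dv t‖ₑ) volume :=
    (aemeasurable_indicator_iff hB).2 hv.integrableOn_grad.1.enorm
  refine (lintegral_rpow_le_of_le_lintegral_kernel
    (k := fun x t => ENNReal.ofReal (ρ.normed volume (x - t)))
    (ENNReal.measurable_ofReal.comp hcont.measurable) (lintegral_normed_sub ρ)
    (lintegral_normed_sub_right ρ) hhm hp hA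
    fun x hx => (enorm_fderiv_mollify_le hB hv (hAB x hx)).trans_eq ?_).trans_eq ?_
  · rw [← lintegral_indicator hB]
    congr 1 with t
    by_cases ht : t ∈ B <;> simp [ht]
  · rw [← lintegral_indicator hB]
    congr 1 with t
    by_cases ht : t ∈ B <;> simp [ht, (by linarith : 0 < p)]

/-- Fatou's lemma for double integrals of differences over increasing domains. -/
lemma lintegral_lintegral_enorm_sub_rpow_le_of_tendsto {X : Type*} [TopologicalSpace X]
    [SecondCountableTopology X] [MeasurableSpace X] [BorelSpace X] {μ : Measure X} [SFinite μ]
    {B : Set X} (hB : MeasurableSet B) {A : ℕ → Set X} (hAm : ∀ n, MeasurableSet (A n))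
    (hev : ∀ x ∈ B, ∀ᶠ n in atTop, x ∈ A n) {u : ℕ → X → ℝ} (hu : ∀ n, Continuous (u n))
    {v : X → ℝ} (hlim : ∀ᵐ x ∂μ, x ∈ B → Tendsto (fun n => u n x) atTop (𝓝 (v x))) {p : ℝ}
    {C : ℝ≥0∞} (hbd : ∀ n, ∫⁻ x in A n, ∫⁻ y in A n, ‖u n x - u n y‖ₑ ^ p ∂μ ∂μ ≤ C) :
    ∫⁻ x in B, ∫⁻ y in B, ‖v x - v y‖ₑ ^ p ∂μ ∂μ ≤ C := by
  -- Indicators replace the moving domains by a fixed one, as Fatou's lemma requires.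
  let G : ℕ → X → X → ℝ≥0∞ := fun n x y =>
    (A n).indicator (fun x => (A n).indicator (fun y => ‖u n x - u n y‖ₑ ^ p) y) x
  have hGm : ∀ n, Measurable (Function.uncurry (G n)) := fun n => by
    have h1 : Measurable fun z : X × X => ‖u n z.1 - u n z.2‖ₑ ^ p :=
      (((hu n).comp continuous_fst).sub
        ((hu n).comp continuous_snd)).enorm.measurable.pow_const p
    have h2 : Function.uncurry (G n) =
        (A n ×ˢ A n).indicator fun z : X × X => ‖u n z.1 - u n z.2‖ₑ ^ p := by
      ext ⟨x, y⟩
      by_cases hx : x ∈ A n <;> by_cases hy : y ∈ A n <;> simp [G, hx, hy]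
    rw [h2]
    exact h1.indicator ((hAm n).prod (hAm n))
  have hGi : ∀ n, ∫⁻ x in B, ∫⁻ y in B, G n x y ∂μ ∂μ ≤ C := fun n => by
    refine le_trans ?_ (hbd n)
    rw [← lintegral_indicator (hAm n)]
    refine (setLIntegral_le_lintegral _ _).trans (lintegral_mono fun x => ?_)
    by_cases hx : x ∈ A n
    · simp only [G, indicator_of_mem hx]
      rw [← lintegral_indicator (hAm n)]
      exact setLIntegral_le_lintegral _ _
    · simp [G, hx]
  have hGlim : ∀ᵐ x ∂(μ.restrict B), ∀ᵐ y ∂(μ.restrict B),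
      ‖v x - v y‖ₑ ^ p ≤ liminf (fun n => G n x y) atTop := by
    have hl := (ae_restrict_iff' hB).2 hlim
    filter_upwards [hl, ae_restrict_mem hB] with x hx hxB
    filter_upwards [hl, ae_restrict_mem hB] with y hy hyB
    have h1 : Tendsto (fun n => ‖u n x - u n y‖ₑ ^ p) atTop (𝓝 (‖v x - v y‖ₑ ^ p)) :=
      ((ENNReal.continuous_rpow_const.tendsto _).comp ((hx.sub hy).enorm))
    refine (h1.congr' ?_).liminf_eq.ge
    filter_upwards [hev x hxB, hev y hyB] with n h2 h3
    simp [G, h2, h3]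
  calc ∫⁻ x in B, ∫⁻ y in B, ‖v x - v y‖ₑ ^ p ∂μ ∂μ
      ≤ ∫⁻ x in B, ∫⁻ y in B, liminf (fun n => G n x y) atTop ∂μ ∂μ :=
        lintegral_mono_ae (hGlim.mono fun x hx => lintegral_mono_ae hx)
    _ ≤ ∫⁻ x in B, liminf (fun n => ∫⁻ y in B, G n x y ∂μ) atTop ∂μ :=
        lintegral_mono fun x => lintegral_liminf_le fun n => (hGm n).of_uncurry_left
    _ ≤ liminf (fun n => ∫⁻ x in B, ∫⁻ y in B, G n x y ∂μ ∂μ) atTop :=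
        lintegral_liminf_le fun n => (hGm n).lintegral_prod_right
    _ ≤ C := liminf_le_of_le (by isBoundedDefault) fun b hb => by
        obtain ⟨n, hn⟩ := hb.exists
        exact hn.trans (hGi n)

/-- The Poincaré inequality in a ball, for Sobolev functions. -/
theorem IsW11Gradient.lintegral_lintegral_enorm_sub_rpow_le {R : ℝ} (hR : 0 < R)
    (hv : IsW11Gradient (Metric.ball 0 R) v Dv) {p : ℝ} (hp : 1 < p) :
    ∫⁻ x in Metric.ball 0 R, ∫⁻ y in Metric.ball 0 R, ‖v x - v y‖ₑ ^ p ≤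
      ENNReal.ofReal (2 * R) ^ p * (2 ^ d * volume (Metric.ball (0 : EuclideanSpace ℝ (Fin d)) R) *
        ∫⁻ x in Metric.ball 0 R, ‖Dv x‖ₑ ^ p) := by
  set B : Set 𝔼 := Metric.ball 0 R with hBdef
  have hB : MeasurableSet B := measurableSet_ball
  -- The shift by `2` keeps `δ n` at most `R / 2`. The bumps below have outer radius `δ n` and inner
  -- radius `δ n / 2`; the bounded ratio is what almost everywhere convergence needs.
  let δ : ℕ → ℝ := fun n => R / (n + 2)
  have hδ : ∀ n, 0 < δ n := fun n => by positivity
  have hδ0 : Tendsto δ atTop (𝓝 0) :=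
    tendsto_const_nhds.div_atTop (tendsto_atTop_add_const_right _ _ tendsto_natCast_atTop_atTop)
  let ρ : ℕ → ContDiffBump (0 : 𝔼) := fun n => ⟨δ n / 2, δ n, by linarith [hδ n], by linarith [hδ n]⟩
  let A : ℕ → Set 𝔼 := fun n => Metric.ball 0 (R - δ n)
  have hAm : ∀ n, MeasurableSet (A n) := fun n => measurableSet_ball
  have hAB : ∀ n, ∀ x ∈ A n, Metric.closedBall x (ρ n).rOut ⊆ B := fun n x hx => by
    refine Metric.closedBall_subset_ball' ?_
    have : dist x 0 < R - δ n := hx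
    change δ n + dist x 0 < R
    linarith
  have hAsub : ∀ n, A n ⊆ B := fun n => Metric.ball_subset_ball (by linarith [hδ n])
  let u : ℕ → 𝔼 → ℝ := fun n => mollify (ρ n) B v
  have hu : ∀ n, ContDiff ℝ 1 (u n) := fun n => contDiff_mollify hB hv.integrableOn
  have hlim : ∀ᵐ x, x ∈ B → Tendsto (fun n => u n x) atTop (𝓝 (v x)) := by
    have h := ContDiffBump.ae_convolution_tendsto_right_of_locallyIntegrable (μ := volume)
      (φ := ρ) (K := 2) hδ0 (Eventually.of_forall fun n => by
        change δ n ≤ 2 * (δ n / 2); linarith)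
      ((integrable_indicator_iff hB).2 hv.integrableOn).locallyIntegrable
    filter_upwards [h] with x hx hxB
    simpa only [u, mollify_eq, indicator_of_mem hxB] using hx
  have hev : ∀ x ∈ B, ∀ᶠ n in atTop, x ∈ A n := fun x hx => by
    have h1 : ‖x‖ < R := by simpa [hBdef] using hx
    filter_upwards [hδ0.eventually_lt_const (show 0 < R - ‖x‖ by linarith)] with n hn
    simp only [A, mem_ball_zero_iff]
    linarith
  set C : ℝ≥0∞ := ENNReal.ofReal (2 * R) ^ p * (2 ^ d * volume B * ∫⁻ x in B, ‖Dv x‖ₑ ^ p) with hC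
  have hbd : ∀ n, ∫⁻ x in A n, ∫⁻ y in A n, ‖u n x - u n y‖ₑ ^ p ≤ C := fun n => by
    refine (GenOrlicz.lintegral_lintegral_enorm_sub_rpow_le volume (hu n) hp
      (convex_ball 0 (R - δ n)) (hAm n) (D := ENNReal.ofReal (2 * R)) ?_).trans ?_
    · intro x hx y hy
      rw [← ofReal_norm]
      refine ENNReal.ofReal_le_ofReal ?_
      have h1 : ‖x‖ < R := by simpa [hBdef] using hAsub n hx
      have h2 : ‖y‖ < R := by simpa [hBdef] using hAsub n hy
      linarith [norm_sub_le y x]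
    · rw [hC, finrank_euclideanSpace_fin]
      refine mul_le_mul' le_rfl (mul_le_mul' (mul_le_mul' le_rfl (measure_mono (hAsub n))) ?_)
      · exact lintegral_enorm_fderiv_mollify_rpow_le hB hv hp (hAm n) (hAB n)
  exact lintegral_lintegral_enorm_sub_rpow_le_of_tendsto hB hAm hev
    (fun n => (hu n).continuous) hlim hbd

end Mollification

/-! ### From oscillation bounds and pointwise convergence to convergence in `L¹`. -/

section LpBound

variable {X : Type*} [MeasurableSpace X] {ν : Measure X}

/-- A pointwise convergent sequence is uniformly bounded on a set of positive measure. -/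
lemma exists_nullMeasurableSet_bound (hν : ν univ ≠ 0) {v : ℕ → X → ℝ} {v₀ : X → ℝ}
    (hm : ∀ j, AEStronglyMeasurable (v j) ν)
    (hlim : ∀ᵐ y ∂ν, Tendsto (fun j => v j y) atTop (𝓝 (v₀ y))) :
    ∃ (A : Set X) (M : ℕ), NullMeasurableSet A ν ∧ ν A ≠ 0 ∧ ∀ j, ∀ y ∈ A, ‖v j y‖ₑ ≤ M := by
  let A : ℕ → Set X := fun M => {y | ∀ j, ‖v j y‖ₑ ≤ (M : ℝ≥0∞)}
  have hA : ∀ M, NullMeasurableSet (A M) ν := fun M => by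
    simp only [A, ofPred_forall]
    exact NullMeasurableSet.iInter fun j =>
      nullMeasurableSet_le (hm j).enorm aemeasurable_const
  by_contra! hcon
  refine hν ?_
  have hzero : ∀ M, ν (A M) = 0 := fun M => by
    by_contra h
    obtain ⟨j, y, hy, hlt⟩ := hcon (A M) M (hA M) h
    exact absurd (hy j) (not_le.2 hlt)
  have hU : ν (⋃ M, A M) = 0 := measure_iUnion_null hzero
  refine measure_mono_null (fun y _ => ?_) (measure_union_null hU (ae_iff.1 hlim))
  by_cases hy : Tendsto (fun j => v j y) atTop (𝓝 (v₀ y))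
  · left
    obtain ⟨C, hC⟩ := (Metric.isBounded_range_of_tendsto _ hy).exists_norm_le
    refine mem_iUnion.2 ⟨⌈C⌉₊, fun j => ?_⟩
    have h1 : ‖v j y‖ ≤ (⌈C⌉₊ : ℝ) := (hC _ ⟨j, rfl⟩).trans (Nat.le_ceil C)
    rw [← ofReal_norm, ← ENNReal.ofReal_natCast]
    exact ENNReal.ofReal_le_ofReal h1
  · exact Or.inr hy

/-- Oscillation and a bound on a set of positive measure control the `L^p` norm. -/
lemma measure_mul_lintegral_rpow_le {A : Set X} (hA : NullMeasurableSet A ν) {v : X → ℝ}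
    {M : ℝ≥0∞} (hM : ∀ y ∈ A, ‖v y‖ₑ ≤ M) {p : ℝ} (hp : 1 < p) (hνA : ν A ≠ ⊤) :
    ν A * ∫⁻ x, ‖v x‖ₑ ^ p ∂ν ≤
      2 ^ (p - 1) * (∫⁻ x, ∫⁻ y, ‖v x - v y‖ₑ ^ p ∂ν ∂ν + M ^ p * ν A * ν univ) := by
  have hpt : ∀ x, ν A * ‖v x‖ₑ ^ p ≤
      2 ^ (p - 1) * (∫⁻ y, ‖v x - v y‖ₑ ^ p ∂ν + M ^ p * ν A) := fun x => by
    calc ν A * ‖v x‖ₑ ^ p = ∫⁻ y in A, ‖v x‖ₑ ^ p ∂ν := by rw [setLIntegral_const, mul_comm]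
      _ ≤ ∫⁻ y in A, 2 ^ (p - 1) * (‖v x - v y‖ₑ ^ p + M ^ p) ∂ν := by
          refine lintegral_mono_ae ?_
          filter_upwards [ae_restrict_mem₀ hA] with y hy
          calc ‖v x‖ₑ ^ p ≤ (‖v x - v y‖ₑ + M) ^ p := by
                gcongr
                calc ‖v x‖ₑ = ‖(v x - v y) + v y‖ₑ := by simp
                  _ ≤ ‖v x - v y‖ₑ + ‖v y‖ₑ := enorm_add_le _ _
                  _ ≤ _ := by gcongr; exact hM y hy
            _ ≤ _ := ENNReal.rpow_add_le_mul_rpow_add_rpow _ _ hp.le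
      _ = 2 ^ (p - 1) * (∫⁻ y in A, ‖v x - v y‖ₑ ^ p ∂ν + M ^ p * ν A) := by
          rw [lintegral_const_mul' _ _ (by simp), lintegral_add_right _ measurable_const,
            setLIntegral_const]
      _ ≤ _ := by gcongr; exact Measure.restrict_le_self
  calc _ = ∫⁻ x, ν A * ‖v x‖ₑ ^ p ∂ν := (lintegral_const_mul' _ _ hνA).symm
    _ ≤ ∫⁻ x, 2 ^ (p - 1) * (∫⁻ y, ‖v x - v y‖ₑ ^ p ∂ν + M ^ p * ν A) ∂ν := lintegral_mono hpt
    _ = _ := by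
        rw [lintegral_const_mul' _ _ (by simp), lintegral_add_right _ measurable_const,
          lintegral_const]

/-- Pointwise convergence together with a bound in `L^p`, `p > 1`, gives convergence in `L¹`. -/
theorem tendsto_L1_of_Lp_bound [IsFiniteMeasure ν] {v : ℕ → X → ℝ} {v₀ : X → ℝ}
    (hm : ∀ j, AEStronglyMeasurable (v j) ν) {p : ℝ} (hp : 1 < p) {K : ℝ≥0∞} (hK : K ≠ ⊤)
    (hbd : ∀ j, ∫⁻ x, ‖v j x‖ₑ ^ p ∂ν ≤ K)
    (hlim : ∀ᵐ y ∂ν, Tendsto (fun j => v j y) atTop (𝓝 (v₀ y))) :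
    Integrable v₀ ν ∧ Tendsto (fun j => eLpNorm (v j - v₀) 1 ν) atTop (𝓝 0) := by
  have hp0 : 0 < p := by linarith
  have hθ : 0 < 1 - 1 / p := by
    rw [sub_pos, div_lt_one hp0]; exact hp
  set N : ℝ≥0∞ := K ^ (1 / p) with hN
  have hN' : N ≠ ⊤ := ENNReal.rpow_ne_top_of_nonneg (by positivity) hK
  have hNp : ∀ j, eLpNorm (v j) (ENNReal.ofReal p) ν ≤ N := fun j => by
    rw [eLpNorm_eq_lintegral_rpow_enorm_toReal (by simpa using hp0) ENNReal.ofReal_ne_top,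
      ENNReal.toReal_ofReal hp0.le]
    exact ENNReal.rpow_le_rpow (hbd j) (by positivity)
  have h1p : (1 : ℝ≥0∞) ≤ ENNReal.ofReal p := by
    rw [← ENNReal.ofReal_one]; exact ENNReal.ofReal_le_ofReal hp.le
  -- Hölder's inequality: the positive exponent `1 - 1 / p` of `ν s` gives the uniform integrability
  -- for Vitali's theorem.
  have hset : ∀ j (s : Set X), eLpNorm (v j) 1 (ν.restrict s) ≤ N * ν s ^ (1 - 1 / p) :=
    fun j s => by
    refine (eLpNorm_le_eLpNorm_mul_rpow_measure_univ h1p (hm j).restrict).trans ?_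
    simp only [ENNReal.toReal_one, div_one, ENNReal.toReal_ofReal hp0.le, Measure.restrict_apply,
      MeasurableSet.univ, univ_inter]
    gcongr
    exact (eLpNorm_mono_measure _ Measure.restrict_le_self).trans (hNp j)
  have hm₀ : AEStronglyMeasurable v₀ ν := aestronglyMeasurable_of_tendsto_ae _ hm hlim
  have hmem : MemLp v₀ 1 ν := by
    refine ⟨hm₀, ?_⟩
    have hfin : N * ν univ ^ (1 - 1 / p) < ⊤ :=
      ENNReal.mul_lt_top hN'.lt_top
        (ENNReal.rpow_lt_top_of_nonneg hθ.le (measure_ne_top ν univ))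
    refine lt_of_le_of_lt ?_ hfin
    refine (Lp.eLpNorm_lim_le_liminf_eLpNorm hm v₀ hlim).trans ?_
    refine liminf_le_of_le (by isBoundedDefault) fun b hb => ?_
    obtain ⟨n, hn⟩ := hb.exists
    have := hset n univ
    rw [Measure.restrict_univ] at this
    exact hn.trans this
  refine ⟨memLp_one_iff_integrable.1 hmem,
    tendsto_Lp_finite_of_tendsto_ae le_rfl ENNReal.one_ne_top hm hmem ?_ hlim⟩
  intro ε hε
  have hT : Tendsto (fun δ : ℝ => N * ENNReal.ofReal δ ^ (1 - 1 / p)) (𝓝[>] 0) (𝓝 0) := by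
    have h1 : Tendsto (fun δ : ℝ => ENNReal.ofReal δ ^ (1 - 1 / p)) (𝓝[>] 0) (𝓝 0) := by
      have h2 : Continuous fun δ : ℝ => ENNReal.ofReal δ ^ (1 - 1 / p) :=
        ENNReal.continuous_rpow_const.comp ENNReal.continuous_ofReal
      have h3 := h2.tendsto 0
      rw [ENNReal.ofReal_zero, ENNReal.zero_rpow_of_pos hθ] at h3
      exact h3.mono_left nhdsWithin_le_nhds
    simpa using ENNReal.Tendsto.const_mul h1 (Or.inr hN')
  obtain ⟨δ, hδ, hδ0⟩ := ((hT.eventually_lt_const (ENNReal.ofReal_pos.2 hε)).and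
    self_mem_nhdsWithin).exists
  refine ⟨δ, hδ0, fun j s hs hνs => ?_⟩
  rw [eLpNorm_indicator_eq_eLpNorm_restrict hs]
  refine (hset j s).trans (le_trans ?_ hδ.le)
  gcongr

end LpBound

/-! ### Uniqueness and stability of weak gradients. -/

section Gradient

variable {d : ℕ} {U : Set (EuclideanSpace ℝ (Fin d))} {v : EuclideanSpace ℝ (Fin d) → ℝ}
  {g g' : EuclideanSpace ℝ (Fin d) → EuclideanSpace ℝ (Fin d)}

/-- The weak gradient is unique. -/
theorem IsW11Gradient.ae_eq (hU : IsOpen U) (hg : IsW11Gradient U v g)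
    (hg' : IsW11Gradient U v g') : g =ᵐ[volume.restrict U] g' := by
  have hcomp : ∀ i : Fin d, ∀ᵐ x, x ∈ U → g x i - g' x i = 0 := fun i => by
    have hi : ∀ {h : EuclideanSpace ℝ (Fin d) → EuclideanSpace ℝ (Fin d)}, IntegrableOn h U →
        IntegrableOn (fun x => h x i) U := fun hh =>
      (EuclideanSpace.proj (𝕜 := ℝ) i).integrable_comp hh
    refine hU.ae_eq_zero_of_integral_contDiff_smul_eq_zero
      (IntegrableOn.locallyIntegrableOn
        ((hi hg.integrableOn_grad).sub (hi hg'.integrableOn_grad))) ?_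
    intro η hη hηc hηU
    have hb : ∀ {h : EuclideanSpace ℝ (Fin d) → EuclideanSpace ℝ (Fin d)}, IntegrableOn h U →
        IntegrableOn (fun x => h x i * η x) U := fun hh => by
      obtain ⟨K, hK⟩ := hηc.exists_bound_of_continuous hη.continuous
      exact (hi hh).mul_bdd hη.continuous.aestronglyMeasurable (ae_of_all _ hK)
    have h1 := (hg.integral_eq η hη hηc hηU i).symm.trans (hg'.integral_eq η hη hηc hηU i)
    rw [neg_inj] at h1
    rw [← setIntegral_eq_integral_of_forall_compl_eq_zero (s := U)]
    · have h2 := integral_sub (hb hg.integrableOn_grad) (hb hg'.integrableOn_grad)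
      rw [h1, sub_self] at h2
      rw [← h2]
      congr 1 with x
      simp only [smul_eq_mul]
      ring
    · intro x hx
      have : η x = 0 := image_eq_zero_of_notMem_tsupport fun h => hx (hηU h)
      simp [this]
  refine (ae_restrict_iff' hU.measurableSet).2 ?_
  filter_upwards [ae_all_iff.2 hcomp] with x hx hxU
  ext i
  exact sub_eq_zero.1 (hx i hxU)

/-- Weak gradients pass to the limit. -/
theorem isW11Gradient_of_tendsto {F : Filter ℕ} [F.NeBot]
    {w : ℕ → EuclideanSpace ℝ (Fin d) → ℝ}
    {Dw : ℕ → EuclideanSpace ℝ (Fin d) → EuclideanSpace ℝ (Fin d)}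
    (hw : ∀ j, IsW11Gradient U (w j) (Dw j)) (hv : IntegrableOn v U) (hg : IntegrableOn g U)
    (hlim : Tendsto (fun j => eLpNorm (w j - v) 1 (volume.restrict U)) F (𝓝 0))
    (hDlim : ∀ η : EuclideanSpace ℝ (Fin d) → EuclideanSpace ℝ (Fin d),
      AEStronglyMeasurable η (volume.restrict U) → (∃ K, ∀ x, ‖η x‖ ≤ K) →
      Tendsto (fun j => ∫ x in U, inner ℝ (Dw j x) (η x)) F (𝓝 (∫ x in U, inner ℝ (g x) (η x)))) :
    IsW11Gradient U v g := by
  refine ⟨hv, hg, fun η hη hηc hηU i => ?_⟩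
  have hη1 : Continuous fun x => fderiv ℝ η x (EuclideanSpace.single i 1) :=
    (hη.continuous_fderiv (by simp)).clm_apply continuous_const
  obtain ⟨K, hK⟩ := hηc.exists_bound_of_continuous hη.continuous
  obtain ⟨L, hL⟩ := (hηc.fderiv_apply ℝ (EuclideanSpace.single i 1)).exists_bound_of_continuous hη1
  have h1 : Tendsto (fun j => ∫ x in U, w j x * fderiv ℝ η x (EuclideanSpace.single i 1)) F
      (𝓝 (∫ x in U, v x * fderiv ℝ η x (EuclideanSpace.single i 1))) := by
    refine tendsto_integral_of_L1' _ (hv.mul_bdd hη1.aestronglyMeasurable (ae_of_all _ hL)).1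
      (Eventually.of_forall fun j =>
        (hw j).integrableOn.mul_bdd hη1.aestronglyMeasurable (ae_of_all _ hL)) ?_
    have h2 : Tendsto (fun j => ENNReal.ofReal L * eLpNorm (w j - v) 1 (volume.restrict U)) F
        (𝓝 0) := by
      simpa using ENNReal.Tendsto.const_mul hlim (Or.inr ENNReal.ofReal_ne_top)
    refine tendsto_of_tendsto_of_tendsto_of_le_of_le tendsto_const_nhds h2 (fun _ => zero_le)
      fun j => ?_
    rw [eLpNorm_one_eq_lintegral_enorm, eLpNorm_one_eq_lintegral_enorm,
      ← lintegral_const_mul' _ _ ENNReal.ofReal_ne_top]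
    refine lintegral_mono fun x => ?_
    simp only [Pi.sub_apply, ← sub_mul, enorm_mul]
    rw [mul_comm]
    gcongr
    rw [← ofReal_norm]
    exact ENNReal.ofReal_le_ofReal (hL x)
  have hin : ∀ (h : EuclideanSpace ℝ (Fin d) → EuclideanSpace ℝ (Fin d)) x,
      inner ℝ (h x) (η x • EuclideanSpace.single i (1 : ℝ)) = h x i * η x := fun h x => by
    rw [inner_smul_right, EuclideanSpace.inner_single_right]
    simp [mul_comm]
  -- Pairing with `η` times a basis vector extracts one component of the gradient.
  have h3 := hDlim (fun x => η x • EuclideanSpace.single i (1 : ℝ))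
    (hη.continuous.smul continuous_const).aestronglyMeasurable
    ⟨K, fun x => by simpa [norm_smul] using hK x⟩
  simp_rw [hin] at h3
  refine tendsto_nhds_unique h1 (h3.neg.congr fun j => ?_)
  exact ((hw j).integral_eq η hη hηc hηU i).symm

end Gradient

/-! ### Supporting lines of the limit integrand. -/

section Tangent

/-- The supporting line of a convex function given by its right derivative. -/
lemma rightDeriv_tangent_le {ψ : ℝ → ℝ} (hψ : ConvexOn ℝ univ ψ) (s t : ℝ) :
    ψ s + derivWithin ψ (Ioi s) s * (t - s) ≤ ψ t := by
  have hs : s ∈ interior (univ : Set ℝ) := by simp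
  rcases lt_trichotomy s t with h | rfl | h
  · have h1 := hψ.rightDeriv_le_slope_of_mem_interior hs (mem_univ t) h
    rw [slope_def_field, le_div_iff₀ (by linarith)] at h1
    linarith
  · simp
  · have h1 := (hψ.slope_le_leftDeriv_of_mem_interior (mem_univ t) hs h).trans
      (hψ.leftDeriv_le_rightDeriv_of_mem_interior hs)
    rw [slope_def_field, div_le_iff₀ (by linarith)] at h1
    linarith

/-- The extension of a nondecreasing convex function on `[0, ∞)` by a constant is convex. -/
lemma convexOn_comp_max_zero {f : ℝ → ℝ} (hf : ConvexOn ℝ (Ici 0) f)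
    (hmono : MonotoneOn f (Ici 0)) : ConvexOn ℝ univ fun t => f (max t 0) := by
  refine ⟨convex_univ, fun x _ y _ a b ha hb hab => ?_⟩
  have hx : max x 0 ∈ Ici (0 : ℝ) := mem_Ici.2 (le_max_right _ _)
  have hy : max y 0 ∈ Ici (0 : ℝ) := mem_Ici.2 (le_max_right _ _)
  refine le_trans (hmono (mem_Ici.2 (le_max_right _ _)) (hf.1 hx hy ha hb hab) ?_) (hf.2 hx hy ha hb hab)
  simp only [smul_eq_mul]
  refine max_le (add_le_add ?_ ?_) (add_nonneg ?_ ?_)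
  · exact mul_le_mul_of_nonneg_left (le_max_left _ _) ha
  · exact mul_le_mul_of_nonneg_left (le_max_left _ _) hb
  · exact mul_nonneg ha hx
  · exact mul_nonneg hb hy

lemma rightDeriv_nonneg_of_monotone {ψ : ℝ → ℝ} (hψ : ConvexOn ℝ univ ψ) (hmono : Monotone ψ)
    (s : ℝ) : 0 ≤ derivWithin ψ (Ioi s) s := by
  have h1 := rightDeriv_tangent_le hψ s (s - 1)
  have h2 := hmono (show s - 1 ≤ s by linarith)
  linarith

lemma rightDeriv_mono {ψ : ℝ → ℝ} (hψ : ConvexOn ℝ univ ψ) :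
    Monotone fun s => derivWithin ψ (Ioi s) s := by
  have := hψ.monotoneOn_rightDeriv
  rwa [interior_univ, monotoneOn_univ] at this

/-- Supporting lines of the limit `ψ` are, up to a small error, below the converging integrands,
provided that these have uniform superlinear growth. -/
theorem eventually_tangent_le {Y : Type*} {B : Set Y} {Φ : ℕ → Y → ℝ → ℝ} {ψ : ℝ → ℝ}
    (hψ : ConvexOn ℝ univ ψ) (hmono : Monotone ψ) {p : ℝ} (hp : 1 < p)
    (hgrowth : ∀ᶠ j in atTop, ∀ y ∈ B, ∀ t : ℝ, 1 ≤ t → t ^ p / 2 ≤ Φ j y t)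
    (hconv : ∀ K : Set ℝ, IsCompact K → K ⊆ Ici 0 →
      TendstoUniformlyOn (fun (j : ℕ) (z : Y × ℝ) => Φ j z.1 z.2) (fun z => ψ z.2) atTop (B ×ˢ K))
    (hψ0 : ∀ t, 0 ≤ ψ t) (k : ℝ) {ε : ℝ} (hε : 0 < ε) :
    ∀ᶠ j in atTop, ∀ y ∈ B, ∀ s ∈ Icc 0 k, ∀ t : ℝ, 0 ≤ t →
      ψ s + derivWithin ψ (Ioi s) s * (t - s) - ε ≤ Φ j y t := by
  set m : ℝ → ℝ := fun s => derivWithin ψ (Ioi s) s with hm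
  have hm0 : ∀ s, 0 ≤ m s := rightDeriv_nonneg_of_monotone hψ hmono
  have hmm : Monotone m := rightDeriv_mono hψ
  -- For `t ≥ T` one has `t ^ p / 2 ≥ (ψ k + m k) t`, which dominates every supporting line taken at
  -- a point of `[0, k]`; only `[0, T]` is left to uniform convergence.
  obtain ⟨T, hT1, hT⟩ := ((eventually_ge_atTop (1 : ℝ)).and (eventually_forall_ge_atTop.2
    ((tendsto_rpow_atTop (sub_pos.2 hp)).eventually_ge_atTop (2 * (ψ k + m k))))).exists
  filter_upwards [hgrowth, Metric.tendstoUniformlyOn_iff.1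
    (hconv (Icc 0 T) isCompact_Icc fun t ht => ht.1) ε hε] with j hj1 hj2 y hy s hs t ht
  rcases le_total t T with h | h
  · have h1 := hj2 (y, t) ⟨hy, ht, h⟩
    rw [Real.dist_eq, abs_lt] at h1
    have h2 := rightDeriv_tangent_le hψ s t
    simp only at h1
    linarith [h1.2]
  · refine le_trans ?_ (hj1 y hy t (hT1.trans h))
    have ht1 : 1 ≤ t := hT1.trans h
    have h1 : t ^ p = t * t ^ (p - 1) := by
      rw [mul_comm, ← Real.rpow_add_one (by linarith)]; simp
    have h2 := hT t h
    have h3 : t * (2 * (ψ k + m k)) ≤ t * t ^ (p - 1) := by gcongr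
    have h4 : ψ s ≤ ψ k * t := (hmono hs.2).trans (le_mul_of_one_le_right (hψ0 k) ht1)
    have h5 : m s * (t - s) ≤ m k * t := by
      calc m s * (t - s) ≤ m s * t := by
            have := mul_nonneg (hm0 s) hs.1
            linarith [mul_sub (m s) t s]
        _ ≤ m k * t := by gcongr; exact hmm hs.2
    change ψ s + m s * (t - s) - ε ≤ _
    rw [h1]
    linarith

end Tangent

/-! ### Lower semicontinuity under weak convergence. -/

section LowerSemicontinuity

variable {X E ι : Type*} [MeasurableSpace X] {ν : Measure X}

/-- Passing to the positive part can only increase the left side and does not change the right side.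
-/
lemma ofReal_integral_le_lintegral_ofReal {f : X → ℝ} (hf : Integrable f ν) :
    ENNReal.ofReal (∫ x, f x ∂ν) ≤ ∫⁻ x, ENNReal.ofReal (f x) ∂ν := by
  have h1 : ∫ x, f x ∂ν ≤ ∫ x, max (f x) 0 ∂ν :=
    integral_mono hf hf.pos_part fun x => le_max_left _ _
  refine (ENNReal.ofReal_le_ofReal h1).trans ?_
  rw [ofReal_integral_eq_lintegral_ofReal hf.pos_part (ae_of_all _ fun x => le_max_right _ _)]
  refine lintegral_mono fun x => ?_
  rw [ENNReal.ofReal_max, ENNReal.ofReal_zero, max_eq_left zero_le]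

variable [IsFiniteMeasure ν] [NormedAddCommGroup E] [InnerProductSpace ℝ E] [MeasurableSpace E]
  [BorelSpace E] [SecondCountableTopology E]

/-- Lower semicontinuity under weak convergence in `L¹`, for integrands that are asymptotically
above all supporting lines of `ψ`. -/
theorem lintegral_le_of_weak_limit {F : Filter ι} [F.NeBot] {ψ m : ℝ → ℝ} (hψ : Measurable ψ)
    (hψm : Monotone ψ) (hψ0 : ∀ t, 0 ≤ ψ t) (hm : Monotone m) (hm0 : ∀ t, 0 ≤ m t)
    {f : ι → X → E} (hf : ∀ j, Integrable (f j) ν) {g : X → E} (hg : Integrable g ν)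
    (hgm : StronglyMeasurable g)
    (hlim : ∀ η : X → E, AEStronglyMeasurable η ν → (∃ K, ∀ x, ‖η x‖ ≤ K) →
      Tendsto (fun j => ∫ x, inner ℝ (f j x) (η x) ∂ν) F (𝓝 (∫ x, inner ℝ (g x) (η x) ∂ν)))
    {Ψ : ι → X → ℝ≥0∞}
    (hΨ : ∀ (k : ℕ) (ε : ℝ), 0 < ε → ∀ᶠ j in F, ∀ᵐ x ∂ν, ∀ s ∈ Icc (0 : ℝ) k,
      ENNReal.ofReal (ψ s + m s * (‖f j x‖ - s) - ε) ≤ Ψ j x)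
    {c : ℝ≥0∞} (hc : ∀ᶠ j in F, ∫⁻ x, Ψ j x ∂ν ≤ c) :
    ∫⁻ x, ENNReal.ofReal (ψ ‖g x‖) ∂ν ≤ c := by
  let S : ℕ → Set X := fun k => {x | ‖g x‖ ≤ k}
  have hS : ∀ k, MeasurableSet (S k) := fun k =>
    measurableSet_le hgm.norm.measurable measurable_const
  have hψg : Measurable fun x => ψ ‖g x‖ := hψ.comp hgm.norm.measurable
  have hSint : ∀ k, Integrable ((S k).indicator fun x => ψ ‖g x‖) ν := fun k => by
    refine Integrable.of_bound (hψg.indicator (hS k)).aestronglyMeasurable (ψ k)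
      (ae_of_all _ fun x => ?_)
    by_cases hx : x ∈ S k
    · simp only [indicator_of_mem hx, Real.norm_of_nonneg (hψ0 _)]
      exact hψm hx
    · simpa [hx] using hψ0 k
  have hstep : ∀ (k : ℕ) (ε : ℝ), 0 < ε →
      ENNReal.ofReal (∫ x, ((S k).indicator (fun x => ψ ‖g x‖) x - ε) ∂ν) ≤ c := by
    intro k ε hε
    -- This is a subgradient of `ξ ↦ ψ ‖ξ‖` at `g x` (zero where `g x = 0`), cut off to `S k` so
    -- that it is bounded and hence an admissible test field.
    let η : X → E := (S k).indicator fun x => (m ‖g x‖ * ‖g x‖⁻¹) • g x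
    have hηm : AEStronglyMeasurable η ν := by
      have h1 : Measurable fun x => m ‖g x‖ * ‖g x‖⁻¹ :=
        (hm.measurable.comp hgm.norm.measurable).mul hgm.norm.measurable.inv
      exact ((h1.smul hgm.measurable).indicator (hS k)).aestronglyMeasurable
    have hηb : ∀ x, ‖η x‖ ≤ m k := fun x => by
      by_cases hx : x ∈ S k
      · simp only [η, indicator_of_mem hx, norm_smul, norm_mul, norm_inv, norm_norm,
          Real.norm_of_nonneg (hm0 _), mul_assoc]
        calc m ‖g x‖ * (‖g x‖⁻¹ * ‖g x‖) ≤ m ‖g x‖ * 1 :=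
              mul_le_mul_of_nonneg_left inv_mul_le_one (hm0 _)
          _ ≤ m k := by rw [mul_one]; exact hm hx
      · simpa [η, hx] using hm0 k
    have hkey : ∀ x (ξ : E), x ∈ S k →
        inner ℝ ξ (η x) - inner ℝ (g x) (η x) ≤ m ‖g x‖ * (‖ξ‖ - ‖g x‖) := fun x ξ hx => by
      simp only [η, indicator_of_mem hx, inner_smul_right, real_inner_self_eq_norm_sq]
      by_cases h0 : ‖g x‖ = 0
      · simp only [h0, inv_zero, mul_zero, zero_mul, sub_zero]
        exact mul_nonneg (hm0 _) (norm_nonneg _)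
      · have h1 : inner ℝ ξ (g x) ≤ ‖ξ‖ * ‖g x‖ := real_inner_le_norm _ _
        have h2 : m ‖g x‖ * ‖g x‖⁻¹ * inner ℝ ξ (g x) ≤ m ‖g x‖ * ‖g x‖⁻¹ * (‖ξ‖ * ‖g x‖) :=
          mul_le_mul_of_nonneg_left h1 (mul_nonneg (hm0 _) (by positivity))
        calc _ ≤ m ‖g x‖ * ‖g x‖⁻¹ * (‖ξ‖ * ‖g x‖) - m ‖g x‖ * ‖g x‖⁻¹ * ‖g x‖ ^ 2 := by linarith
          _ = _ := by field_simp
    have hfη : ∀ j, Integrable (fun x => inner ℝ (f j x) (η x)) ν := fun j =>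
      integrable_inner_of_norm_le (hf j) hηm hηb
    have hgη : Integrable (fun x => inner ℝ (g x) (η x)) ν :=
      integrable_inner_of_norm_le hg hηm hηb
    have hlow : ∀ᶠ j in F, ENNReal.ofReal (∫ x, ((S k).indicator (fun x => ψ ‖g x‖) x - ε) ∂ν +
        (∫ x, inner ℝ (f j x) (η x) ∂ν - ∫ x, inner ℝ (g x) (η x) ∂ν)) ≤ c := by
      filter_upwards [hΨ k ε hε, hc] with j hj hcj
      refine le_trans ?_ hcj
      have hI : Integrable (fun x => (S k).indicator (fun x => ψ ‖g x‖) x - ε) ν :=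
        (hSint k).sub (integrable_const (μ := ν) ε)
      have hJ : Integrable (fun x => inner ℝ (f j x) (η x) - inner ℝ (g x) (η x)) ν :=
        (hfη j).sub hgη
      rw [← integral_sub (hfη j) hgη, ← integral_add hI hJ]
      refine (ofReal_integral_le_lintegral_ofReal (hI.add hJ)).trans
        (lintegral_mono_ae ?_)
      filter_upwards [hj] with x hx
      by_cases hxS : x ∈ S k
      · refine le_trans (ENNReal.ofReal_le_ofReal ?_) (hx ‖g x‖ ⟨norm_nonneg _, hxS⟩)
        have := hkey x (f j x) hxS
        change (S k).indicator (fun x => ψ ‖g x‖) x - ε +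
          (inner ℝ (f j x) (η x) - inner ℝ (g x) (η x)) ≤ _
        rw [indicator_of_mem hxS]
        linarith
      · refine (ENNReal.ofReal_of_nonpos ?_).trans_le zero_le
        simp [hxS, η, hε.le]
    refine le_of_tendsto (ENNReal.tendsto_ofReal ?_) hlow
    simpa using ((hlim η hηm ⟨m k, hηb⟩).sub_const (∫ x, inner ℝ (g x) (η x) ∂ν)).const_add
      (∫ x, ((S k).indicator (fun x => ψ ‖g x‖) x - ε) ∂ν)
  have hSk : ∀ k, ∫⁻ x, ENNReal.ofReal ((S k).indicator (fun x => ψ ‖g x‖) x) ∂ν ≤ c := by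
    intro k
    rw [← ofReal_integral_eq_lintegral_ofReal (hSint k)
      (ae_of_all _ fun x => indicator_nonneg (fun _ _ => hψ0 _) x)]
    have h1 : Tendsto (fun ε : ℝ => ENNReal.ofReal
        (∫ x, (S k).indicator (fun x => ψ ‖g x‖) x ∂ν - ν.real univ * ε)) (𝓝[>] 0)
        (𝓝 (ENNReal.ofReal (∫ x, (S k).indicator (fun x => ψ ‖g x‖) x ∂ν))) := by
      refine (Continuous.tendsto' ?_ 0 _ (by simp)).mono_left nhdsWithin_le_nhds
      exact ENNReal.continuous_ofReal.comp (by fun_prop)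
    refine le_of_tendsto h1 ?_
    filter_upwards [self_mem_nhdsWithin] with ε hε
    have := hstep k ε hε
    rwa [integral_sub (hSint k) (integrable_const _), integral_const, smul_eq_mul] at this
  calc ∫⁻ x, ENNReal.ofReal (ψ ‖g x‖) ∂ν
      = ∫⁻ x, liminf (fun k => ENNReal.ofReal ((S k).indicator (fun x => ψ ‖g x‖) x)) atTop ∂ν := by
        refine lintegral_congr fun x => (Tendsto.liminf_eq ?_).symm
        refine tendsto_const_nhds.congr' ?_
        filter_upwards [eventually_ge_atTop ⌈‖g x‖⌉₊] with k hk
        have : x ∈ S k :=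
          show ‖g x‖ ≤ (k : ℝ) from (Nat.le_ceil _).trans (by exact_mod_cast hk)
        rw [indicator_of_mem this]
    _ ≤ liminf (fun k => ∫⁻ x, ENNReal.ofReal ((S k).indicator (fun x => ψ ‖g x‖) x) ∂ν) atTop :=
        lintegral_liminf_le fun k => (hψg.indicator (hS k)).ennreal_ofReal
    _ ≤ c := liminf_le_of_le (by isBoundedDefault) fun b hb => by
        obtain ⟨n, hn⟩ := hb.exists
        exact hn.trans (hSk n)

end LowerSemicontinuity

/-! ### Power growth from monotonicity of the derivative quotient. -/

section Integrand

/-- If `ψ' / t ^ (p - 1)` is nondecreasing, then `ψ` grows at least with the power `p`. -/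
lemma rpow_mul_le_of_monotoneOn {ψ : ℝ → ℝ} (hψ : ContDiffOn ℝ 1 ψ (Ici 0)) (h0 : ψ 0 = 0) {p : ℝ}
    (hinc : MonotoneOn (fun t : ℝ => derivWithin ψ (Ioi t) t / t ^ (p - 1)) (Ioi 0)) {l : ℝ}
    (hl : 1 ≤ l) {s : ℝ} (hs : 0 ≤ s) : l ^ p * ψ s ≤ ψ (l * s) := by
  have hl0 : 0 < l := by linarith
  have hd : ∀ t, 0 < t → HasDerivAt ψ (derivWithin ψ (Ioi t) t) t := fun t ht => by
    have h1 : DifferentiableAt ℝ ψ t :=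
      (hψ.differentiableOn one_ne_zero t ht.le).differentiableAt (Ici_mem_nhds ht)
    rw [h1.derivWithin (uniqueDiffWithinAt_Ioi t)]
    exact h1.hasDerivAt
  have hD : ∀ t, 0 < t → HasDerivAt (fun s => ψ (l * s) - l ^ p * ψ s)
      (derivWithin ψ (Ioi (l * t)) (l * t) * l - l ^ p * derivWithin ψ (Ioi t) t) t :=
    fun t ht => by
    have h1 : HasDerivAt (fun s : ℝ => l * s) l t := by
      simpa using (hasDerivAt_id t).const_mul l
    exact ((hd (l * t) (by positivity)).comp t h1).sub ((hd t ht).const_mul _)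
  -- The hypothesis compares the derivative at `l * t` with `l ^ (p - 1)` times that at `t`; the
  -- chain rule supplies the missing factor `l`.
  have hmono : MonotoneOn (fun s => ψ (l * s) - l ^ p * ψ s) (Ici 0) := by
    refine monotoneOn_of_deriv_nonneg (convex_Ici 0) ?_ ?_ ?_
    · refine ContinuousOn.sub (hψ.continuousOn.comp (by fun_prop) fun s hs => ?_)
        (continuousOn_const.mul hψ.continuousOn)
      exact mul_nonneg hl0.le hs
    · intro t ht
      rw [interior_Ici] at ht
      exact (hD t ht).differentiableAt.differentiableWithinAt
    · intro t ht
      rw [interior_Ici] at ht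
      have ht0 : 0 < t := ht
      rw [(hD t ht).deriv]
      have h1 := hinc ht (show l * t ∈ Ioi (0 : ℝ) from mul_pos hl0 ht)
        (le_mul_of_one_le_left ht0.le hl)
      simp only at h1
      rw [Real.mul_rpow hl0.le ht0.le, div_le_div_iff₀ (by positivity) (by positivity)] at h1
      have h2 : l ^ (p - 1) * derivWithin ψ (Ioi t) t ≤ derivWithin ψ (Ioi (l * t)) (l * t) := by
        refine le_of_mul_le_mul_right ?_ (Real.rpow_pos_of_pos ht0 (p - 1))
        linarith
      have h3 : l ^ p = l ^ (p - 1) * l := by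
        rw [← Real.rpow_add_one hl0.ne']; simp
      have h4 := mul_le_mul_of_nonneg_right h2 hl0.le
      rw [h3]
      linarith
  have h1 := hmono (mem_Ici.2 le_rfl) hs hs
  simp only [mul_zero, h0, sub_self] at h1
  linarith

end Integrand

/-! ### Compactness and lower semicontinuity for sequences with bounded gradients. -/

section Compactness

/-- A bound in `L^p` with `p > 1` gives equiintegrability. -/
lemma exists_integral_sub_trunc_le {X E ι : Type*} [MeasurableSpace X] {ν : Measure X}
    [NormedAddCommGroup E] [MeasurableSpace E] [BorelSpace E] [SecondCountableTopology E]
    {F : Filter ι} {f : ι → X → E} (hf : ∀ j, AEStronglyMeasurable (f j) ν) {p : ℝ} (hp : 1 < p)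
    {K : ℝ≥0∞} (hK : K ≠ ⊤) (hbd : ∀ᶠ j in F, ∫⁻ x, ‖f j x‖ₑ ^ p ∂ν ≤ K) {ε : ℝ} (hε : 0 < ε) :
    ∃ k : ℕ, ∀ᶠ j in F, ∫ x, ‖f j x - trunc k (f j x)‖ ∂ν ≤ ε := by
  have hT : Tendsto (fun k : ℕ => ENNReal.ofReal ((k : ℝ) ^ (1 - p)) * K) atTop (𝓝 0) := by
    have h1 : Tendsto (fun k : ℕ => (k : ℝ) ^ (1 - p)) atTop (𝓝 0) := by
      have := (tendsto_rpow_neg_atTop (sub_pos.2 hp)).comp tendsto_natCast_atTop_atTop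
      simpa [Function.comp_def] using this
    have h2 := ENNReal.tendsto_ofReal h1
    rw [ENNReal.ofReal_zero] at h2
    simpa using ENNReal.Tendsto.mul_const h2 (Or.inr hK)
  obtain ⟨k, hk, hk0⟩ := ((hT.eventually_lt_const (ENNReal.ofReal_pos.2 hε)).and
    (eventually_gt_atTop 0)).exists
  refine ⟨k, ?_⟩
  filter_upwards [hbd] with j hj
  have hm : AEStronglyMeasurable (fun x => f j x - trunc k (f j x)) ν :=
    (hf j).sub ((measurable_trunc k).comp_aemeasurable (hf j).aemeasurable).aestronglyMeasurable
  rw [integral_norm_eq_lintegral_enorm hm]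
  refine ENNReal.toReal_le_of_le_ofReal hε.le (le_trans ?_ hk.le)
  refine le_trans ?_ (mul_le_mul' le_rfl hj)
  rw [← lintegral_const_mul' _ _ ENNReal.ofReal_ne_top]
  refine lintegral_mono fun x => ?_
  rw [← ofReal_norm, ← ofReal_norm, ENNReal.ofReal_rpow_of_nonneg (norm_nonneg _) (by linarith),
    ← ENNReal.ofReal_mul (by positivity)]
  exact ENNReal.ofReal_le_ofReal (norm_sub_trunc_le_rpow hp hk0 _)

variable {d : ℕ} {R : ℝ} {v : ℕ → EuclideanSpace ℝ (Fin d) → ℝ}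
  {Dv : ℕ → EuclideanSpace ℝ (Fin d) → EuclideanSpace ℝ (Fin d)}
  {v₀ : EuclideanSpace ℝ (Fin d) → ℝ} {p : ℝ} {K : ℝ≥0∞}

/-- Sobolev functions on a ball that converge almost everywhere and whose gradients are bounded in
`L^p`, `p > 1`, converge in `L¹`. -/
theorem tendsto_L1_of_gradient_bound (hR : 0 < R)
    (hv : ∀ j, IsW11Gradient (Metric.ball 0 R) (v j) (Dv j)) (hp : 1 < p) (hK : K ≠ ⊤)
    (hbd : ∀ᶠ j in atTop, ∫⁻ x in Metric.ball 0 R, ‖Dv j x‖ₑ ^ p ≤ K)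
    (hlim : ∀ᵐ y ∂(volume.restrict (Metric.ball (0 : EuclideanSpace ℝ (Fin d)) R)),
      Tendsto (fun j => v j y) atTop (𝓝 (v₀ y))) :
    IntegrableOn v₀ (Metric.ball 0 R) ∧
      Tendsto (fun j => eLpNorm (v j - v₀) 1 (volume.restrict (Metric.ball 0 R))) atTop (𝓝 0) := by
  set B : Set (EuclideanSpace ℝ (Fin d)) := Metric.ball 0 R with hB
  have hBfin : volume B ≠ ⊤ := measure_ball_lt_top.ne
  have : IsFiniteMeasure (volume.restrict B) := ⟨by simpa using hBfin.lt_top⟩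
  have hBpos : volume.restrict B univ ≠ 0 := by
    simpa using (Metric.measure_ball_pos volume (0 : EuclideanSpace ℝ (Fin d)) hR).ne'
  obtain ⟨A, M, hA, hA0, hM⟩ := exists_nullMeasurableSet_bound hBpos
    (fun j => (hv j).integrableOn.1) hlim
  have hAfin : volume.restrict B A ≠ ⊤ := measure_ne_top _ _
  -- The gradient bound holds only eventually, so the sequence is shifted by `J`.
  obtain ⟨J, hJ⟩ := eventually_atTop.1 hbd
  set Q : ℝ≥0∞ := 2 ^ (p - 1) * (ENNReal.ofReal (2 * R) ^ p * (2 ^ d * volume B * K) +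
    M ^ p * volume.restrict B A * volume.restrict B univ) with hQ
  have hQfin : Q ≠ ⊤ := by
    have hp0 : 0 ≤ p := by linarith
    refine ENNReal.mul_ne_top (by simp) (ENNReal.add_ne_top.2 ⟨?_, ?_⟩)
    · exact ENNReal.mul_ne_top (ENNReal.rpow_ne_top_of_nonneg hp0 ENNReal.ofReal_ne_top)
        (ENNReal.mul_ne_top (ENNReal.mul_ne_top (by simp) hBfin) hK)
    · exact ENNReal.mul_ne_top (ENNReal.mul_ne_top
        (ENNReal.rpow_ne_top_of_nonneg hp0 (by simp)) hAfin) (measure_ne_top _ _)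
  have hbound : ∀ j, ∫⁻ x in B, ‖v (j + J) x‖ₑ ^ p ≤ Q / volume.restrict B A := fun j => by
    rw [ENNReal.le_div_iff_mul_le (Or.inl hA0) (Or.inl hAfin), mul_comm]
    refine (measure_mul_lintegral_rpow_le hA (hM (j + J)) hp hAfin).trans ?_
    refine mul_le_mul' le_rfl (add_le_add ?_ le_rfl)
    refine ((hv (j + J)).lintegral_lintegral_enorm_sub_rpow_le hR hp).trans ?_
    exact mul_le_mul' le_rfl (mul_le_mul' le_rfl (hJ (j + J) (Nat.le_add_left _ _)))
  obtain ⟨h1, h2⟩ := tendsto_L1_of_Lp_bound (fun j => (hv (j + J)).integrableOn.1) hp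
    (ENNReal.div_ne_top hQfin hA0) hbound
    (hlim.mono fun y hy => (tendsto_add_atTop_iff_nat J).2 hy)
  exact ⟨h1, (tendsto_add_atTop_iff_nat J
    (f := fun j => eLpNorm (v j - v₀) 1 (volume.restrict B))).1 h2⟩

/-- Under the same assumptions, the gradients converge weakly, along every ultrafilter, to the
gradient of the limit. -/
theorem exists_weak_limit_gradient (hR : 0 < R)
    (hv : ∀ j, IsW11Gradient (Metric.ball 0 R) (v j) (Dv j)) (hp : 1 < p) (hK : K ≠ ⊤)
    (hbd : ∀ᶠ j in atTop, ∫⁻ x in Metric.ball 0 R, ‖Dv j x‖ₑ ^ p ≤ K)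
    (hlim : ∀ᵐ y ∂(volume.restrict (Metric.ball (0 : EuclideanSpace ℝ (Fin d)) R)),
      Tendsto (fun j => v j y) atTop (𝓝 (v₀ y)))
    (U : Ultrafilter ℕ) (hU : (U : Filter ℕ) ≤ atTop) :
    ∃ g, IsW11Gradient (Metric.ball 0 R) v₀ g ∧
      ∀ η : EuclideanSpace ℝ (Fin d) → EuclideanSpace ℝ (Fin d),
        AEStronglyMeasurable η (volume.restrict (Metric.ball 0 R)) → (∃ L, ∀ x, ‖η x‖ ≤ L) →
        Tendsto (fun j => ∫ x in Metric.ball 0 R, inner ℝ (Dv j x) (η x)) U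
          (𝓝 (∫ x in Metric.ball 0 R, inner ℝ (g x) (η x))) := by
  have : IsFiniteMeasure (volume.restrict (Metric.ball (0 : EuclideanSpace ℝ (Fin d)) R)) :=
    ⟨by simpa using measure_ball_lt_top⟩
  obtain ⟨hint, hL1⟩ := tendsto_L1_of_gradient_bound hR hv hp hK hbd hlim
  obtain ⟨g, hg, hgl⟩ := exists_weak_limit_of_equiintegrable U Dv
    (fun j => (hv j).integrableOn_grad) fun ε hε =>
      exists_integral_sub_trunc_le (fun j => (hv j).integrableOn_grad.1) hp hK
        (hbd.filter_mono hU) hε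
  exact ⟨g, isW11Gradient_of_tendsto hv hint hg (hL1.mono_left hU) hgl, hgl⟩

/-- Lower semicontinuity of integral functionals whose integrands converge locally uniformly and
have uniform superlinear growth. -/
theorem lintegral_le_liminf_of_tendsto (hR : 0 < R)
    (hv : ∀ j, IsW11Gradient (Metric.ball 0 R) (v j) (Dv j)) (hp : 1 < p) (hK : K ≠ ⊤)
    (hbd : ∀ᶠ j in atTop, ∫⁻ x in Metric.ball 0 R, ‖Dv j x‖ₑ ^ p ≤ K)
    (hlim : ∀ᵐ y ∂(volume.restrict (Metric.ball (0 : EuclideanSpace ℝ (Fin d)) R)),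
      Tendsto (fun j => v j y) atTop (𝓝 (v₀ y)))
    {Φ : ℕ → EuclideanSpace ℝ (Fin d) → ℝ → ℝ} {ψ : ℝ → ℝ} (hψ : ConvexOn ℝ univ ψ)
    (hmono : Monotone ψ) (hψ0 : ∀ t, 0 ≤ ψ t)
    (hgrowth : ∀ᶠ j in atTop, ∀ y ∈ Metric.ball 0 R, ∀ t : ℝ, 1 ≤ t → t ^ p / 2 ≤ Φ j y t)
    (hconv : ∀ S : Set ℝ, IsCompact S → S ⊆ Ici 0 →
      TendstoUniformlyOn (fun (j : ℕ) (z : EuclideanSpace ℝ (Fin d) × ℝ) => Φ j z.1 z.2)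
        (fun z => ψ z.2) atTop (Metric.ball 0 R ×ˢ S))
    {Dv₀ : EuclideanSpace ℝ (Fin d) → EuclideanSpace ℝ (Fin d)}
    (hDv₀ : IsW11Gradient (Metric.ball 0 R) v₀ Dv₀) :
    ∫⁻ y in Metric.ball 0 R, ENNReal.ofReal (ψ ‖Dv₀ y‖) ≤
      liminf (fun j => ∫⁻ y in Metric.ball 0 R, ENNReal.ofReal (Φ j y ‖Dv j y‖)) atTop := by
  set B : Set (EuclideanSpace ℝ (Fin d)) := Metric.ball 0 R with hB
  have : IsFiniteMeasure (volume.restrict B) := ⟨by simpa using measure_ball_lt_top⟩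
  refine le_of_forall_gt_imp_ge_of_dense fun c hc => ?_
  -- For `c` above the lower limit, energies below `c` occur infinitely often; an ultrafilter
  -- containing these indices plays the role of a subsequence.
  have hne : (atTop ⊓ 𝓟 {j | ∫⁻ y in B, ENNReal.ofReal (Φ j y ‖Dv j y‖) < c}).NeBot :=
    frequently_mem_iff_neBot.1 (frequently_lt_of_liminf_lt (by isBoundedDefault) hc)
  set U := Ultrafilter.of (atTop ⊓ 𝓟 {j | ∫⁻ y in B, ENNReal.ofReal (Φ j y ‖Dv j y‖) < c})
  have hU : (U : Filter ℕ) ≤ atTop := (Ultrafilter.of_le _).trans inf_le_left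
  have hUc : ∀ᶠ j in (U : Filter ℕ), ∫⁻ y in B, ENNReal.ofReal (Φ j y ‖Dv j y‖) < c :=
    le_principal_iff.1 ((Ultrafilter.of_le _).trans inf_le_right)
  obtain ⟨g, hg, hgl⟩ := exists_weak_limit_gradient hR hv hp hK hbd hlim U hU
  have hgD : Dv₀ =ᵐ[volume.restrict B] hg.integrableOn_grad.1.mk g :=
    (hDv₀.ae_eq Metric.isOpen_ball hg).trans hg.integrableOn_grad.1.ae_eq_mk
  rw [lintegral_congr_ae (g := fun y => ENNReal.ofReal (ψ ‖hg.integrableOn_grad.1.mk g y‖))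
    (hgD.mono fun y hy => by simp only [hy])]
  refine lintegral_le_of_weak_limit (F := U) (m := fun s => derivWithin ψ (Ioi s) s)
    (Ψ := fun j y => ENNReal.ofReal (Φ j y ‖Dv j y‖)) hmono.measurable hmono hψ0
    (rightDeriv_mono hψ) (rightDeriv_nonneg_of_monotone hψ hmono)
    (fun j => (hv j).integrableOn_grad)
    (hg.integrableOn_grad.congr hg.integrableOn_grad.1.ae_eq_mk)
    hg.integrableOn_grad.1.stronglyMeasurable_mk (fun η hη hηb => ?_) (fun k ε hε => ?_)
    (hUc.mono fun j hj => hj.le)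
  · rw [← integral_congr_ae (f := fun x => inner ℝ (g x) (η x))
      (hg.integrableOn_grad.1.ae_eq_mk.mono fun y hy => by simp only [← hy])]
    exact hgl η hη hηb
  · filter_upwards [hU (eventually_tangent_le hψ hmono hp hgrowth hconv hψ0 k hε)] with j hj
    filter_upwards [ae_restrict_mem measurableSet_ball] with y hy s hs
    exact ENNReal.ofReal_le_ofReal (hj y hy s hs _ (norm_nonneg _))

end Compactness

/-! ### The rescaled integrands. -/

section Rescaling

variable {d : ℕ} {Ω : Set (EuclideanSpace ℝ (Fin d))} {φ : EuclideanSpace ℝ (Fin d) → ℝ → ℝ}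
  {r σ : ℕ → ℝ} {φinf : ℝ → ℝ} {R p : ℝ}

lemma IsConvexPhi.nonneg {ψ : ℝ → ℝ} (hψ : IsConvexPhi ψ) {t : ℝ} (ht : 0 ≤ t) : 0 ≤ ψ t := by
  have := hψ.monotoneOn (mem_Ici.2 le_rfl) ht ht
  rwa [hψ.map_zero] at this

/-- The rescaled functions at the origin are convex and nondecreasing, hence so is their limit. -/
lemma limit_rescale_props (h0 : IsConvexPhi (φ 0)) (hσ : ∀ j, 0 ≤ σ j)
    (hσ_top : Tendsto σ atTop atTop)
    (hlim : ∀ t, 0 ≤ t → Tendsto (fun j => rescale φ (r j) (σ j) 0 t) atTop (𝓝 (φinf t))) :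
    ConvexOn ℝ (Ici 0) φinf ∧ MonotoneOn φinf (Ici 0) ∧ φinf 0 = 0 ∧ φinf 1 = 1 := by
  have hc : ∀ j, 0 ≤ φ 0 (σ j) := fun j => h0.nonneg (hσ j)
  have hmul : ∀ j, ∀ t ∈ Ici (0 : ℝ), σ j * t ∈ Ici (0 : ℝ) := fun j t ht => mul_nonneg (hσ j) ht
  refine ⟨⟨convex_Ici 0, fun x hx y hy a b ha hb hab => ?_⟩, fun x hx y hy hxy => ?_, ?_, ?_⟩
  · refine le_of_tendsto_of_tendsto' (hlim _ ((convex_Ici (0 : ℝ)) hx hy ha hb hab))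
      (((hlim x hx).const_smul a).add ((hlim y hy).const_smul b)) fun j => ?_
    have h1 := h0.convexOn.2 (hmul j x hx) (hmul j y hy) ha hb hab
    simp only [smul_eq_mul] at h1
    simp only [rescale, smul_zero, smul_eq_mul]
    rw [← mul_div_assoc, ← mul_div_assoc, ← add_div]
    refine div_le_div_of_nonneg_right (le_trans (le_of_eq ?_) h1) (hc j)
    ring_nf
  · refine le_of_tendsto_of_tendsto' (hlim x hx) (hlim y hy) fun j => ?_
    simp only [rescale, smul_zero]
    exact div_le_div_of_nonneg_right (h0.monotoneOn (hmul j x hx) (hmul j y hy)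
      (mul_le_mul_of_nonneg_left hxy (hσ j))) (hc j)
  · refine tendsto_nhds_unique (hlim 0 le_rfl) (tendsto_const_nhds.congr fun j => ?_)
    simp [rescale, h0.map_zero]
  · refine tendsto_nhds_unique (hlim 1 zero_le_one) (tendsto_const_nhds.congr' ?_)
    filter_upwards [(h0.tendsto_atTop.comp hσ_top).eventually_gt_atTop 0] with j hj
    have hj' : φ 0 (σ j) ≠ 0 := ne_of_gt hj
    simp [rescale, hj']

lemma eventually_smul_mem (hRΩ : Metric.ball (0 : EuclideanSpace ℝ (Fin d)) R ⊆ Ω)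
    (hr : ∀ j, 0 ≤ r j) (hr0 : Tendsto r atTop (𝓝 0)) :
    ∀ᶠ j in atTop, ∀ y ∈ Metric.ball (0 : EuclideanSpace ℝ (Fin d)) R, r j • y ∈ Ω := by
  filter_upwards [hr0.eventually_lt_const one_pos] with j hj y hy
  refine hRΩ ?_
  rw [mem_ball_zero_iff] at hy ⊢
  rw [norm_smul, Real.norm_of_nonneg (hr j)]
  exact (mul_le_of_le_one_left (norm_nonneg _) hj.le).trans_lt hy

/-- The rescaled functions grow at least with the power `p`, uniformly. -/
lemma eventually_rpow_le_rescale (hφ : IsGenConvexPhi Ω φ) (hφ1 : IsC1 Ω φ)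
    (hinc : Inc Ω (p - 1) (rightDeriv φ)) (h0Ω : (0 : EuclideanSpace ℝ (Fin d)) ∈ Ω)
    (hRΩ : Metric.ball (0 : EuclideanSpace ℝ (Fin d)) R ⊆ Ω)
    (hr : ∀ j, 0 ≤ r j) (hσ : ∀ j, 0 ≤ σ j) (hr0 : Tendsto r atTop (𝓝 0))
    (hunif : ∀ᶠ j in atTop, ∀ y ∈ Metric.ball (0 : EuclideanSpace ℝ (Fin d)) R,
      1 / 2 ≤ rescale φ (r j) (σ j) y 1) :
    ∀ᶠ j in atTop, ∀ y ∈ Metric.ball (0 : EuclideanSpace ℝ (Fin d)) R, ∀ t : ℝ, 1 ≤ t →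
      t ^ p / 2 ≤ rescale φ (r j) (σ j) y t := by
  filter_upwards [eventually_smul_mem hRΩ hr hr0, hunif] with j hj hu y hy t ht
  have hx := hj y hy
  have h1 := rpow_mul_le_of_monotoneOn (hφ1 _ hx) (hφ.isConvexPhi _ hx).map_zero (hinc _ hx) ht
    (hσ j)
  have h2 : t ^ p * rescale φ (r j) (σ j) y 1 ≤ rescale φ (r j) (σ j) y t := by
    simp only [rescale, mul_one]
    rw [← mul_div_assoc, mul_comm (σ j) t]
    exact div_le_div_of_nonneg_right h1 ((hφ.isConvexPhi 0 h0Ω).nonneg (hσ j))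
  have h3 := mul_le_mul_of_nonneg_left (hu y hy) (Real.rpow_nonneg (zero_le_one.trans ht) p)
  linarith

/-- Superlinear growth turns an energy bound into a bound in `L^p`. -/
lemma lintegral_enorm_rpow_le {X E : Type*} [MeasurableSpace X] {ν : Measure X}
    [NormedAddCommGroup E] {Φ : X → ℝ → ℝ} (hp : 0 ≤ p) {f : X → E}
    (hΦ : ∀ᵐ x ∂ν, ∀ t : ℝ, 1 ≤ t → t ^ p / 2 ≤ Φ x t) {C : ℝ≥0∞}
    (hC : ∫⁻ x, ENNReal.ofReal (Φ x ‖f x‖) ∂ν ≤ C) :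
    ∫⁻ x, ‖f x‖ₑ ^ p ∂ν ≤ ν univ + 2 * C := by
  calc ∫⁻ x, ‖f x‖ₑ ^ p ∂ν ≤ ∫⁻ x, (1 + 2 * ENNReal.ofReal (Φ x ‖f x‖)) ∂ν := by
        refine lintegral_mono_ae ?_
        filter_upwards [hΦ] with x hx
        rcases le_total ‖f x‖ 1 with h | h
        · refine le_add_right (ENNReal.rpow_le_one ?_ hp)
          rw [← ofReal_norm]
          exact ENNReal.ofReal_le_one.2 h
        · refine le_add_left ?_
          rw [← ofReal_norm, ENNReal.ofReal_rpow_of_nonneg (norm_nonneg _) hp,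
            show (2 : ℝ≥0∞) = ENNReal.ofReal 2 by simp, ← ENNReal.ofReal_mul zero_le_two]
          exact ENNReal.ofReal_le_ofReal (by linarith [hx _ h])
    _ = ν univ + 2 * ∫⁻ x, ENNReal.ofReal (Φ x ‖f x‖) ∂ν := by
        rw [lintegral_add_left measurable_const, lintegral_const_mul' _ _ (by simp), lintegral_const,
          one_mul]
    _ ≤ _ := by gcongr

end Rescaling

end GenOrlicz

/-! ### The lower semicontinuity theorem. -/

theorem mainTheorem7 {d : ℕ} (hd : 2 ≤ d)
    (Ω : Set (EuclideanSpace ℝ (Fin d))) (hΩ : IsOpen Ω)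
    (p q : ℝ) (hp : 1 < p) (hpq : p ≤ q)
    (φ : EuclideanSpace ℝ (Fin d) → ℝ → ℝ)
    (hφ : GenOrlicz.IsGenConvexPhi Ω φ) (hφ1 : GenOrlicz.IsC1 Ω φ) (hVA1 : GenOrlicz.VA1 Ω φ)
    (hA0 : GenOrlicz.A0 Ω (GenOrlicz.rightDeriv φ))
    (hinc : GenOrlicz.Inc Ω (p - 1) (GenOrlicz.rightDeriv φ))
    (hdec : GenOrlicz.Dec Ω (q - 1) (GenOrlicz.rightDeriv φ))
    (R : ℝ) (hR : 0 < R)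
    (hRΩ : closure (Metric.ball (0 : EuclideanSpace ℝ (Fin d)) (2 * R)) ⊆ Ω)
    (r σ : ℕ → ℝ) (hr : ∀ j, 0 ≤ r j) (hσ : ∀ j, 0 ≤ σ j) (hRr : ∀ j, R * r j < 1)
    (hr0 : Tendsto r atTop (𝓝 0)) (hσ_top : Tendsto σ atTop atTop)
    (hφσr : Tendsto (fun j => φ 0 (σ j) * r j) atTop (𝓝 0))
    (φinf : ℝ → ℝ)
    (hconv : ∀ K : Set ℝ, IsCompact K → K ⊆ Ici 0 →
      TendstoUniformlyOn
        (fun (j : ℕ) (z : EuclideanSpace ℝ (Fin d) × ℝ) =>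
          GenOrlicz.rescale φ (r j) (σ j) z.1 z.2)
        (fun z => φinf z.2) atTop (Metric.ball 0 (2 * R) ×ˢ K))
    (v : ℕ → EuclideanSpace ℝ (Fin d) → ℝ)
    (Dv : ℕ → EuclideanSpace ℝ (Fin d) → EuclideanSpace ℝ (Fin d))
    (hv : ∀ j, GenOrlicz.IsW11Gradient (Metric.ball 0 R) (v j) (Dv j))
    (C : ℝ)
    (hbound : ∀ j, ∫⁻ y in Metric.ball 0 R,
      ENNReal.ofReal (GenOrlicz.rescale φ (r j) (σ j) y ‖Dv j y‖) ≤ ENNReal.ofReal C)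
    (v₀ : EuclideanSpace ℝ (Fin d) → ℝ)
    (hv₀ : ∀ᵐ y ∂(volume.restrict (Metric.ball (0 : EuclideanSpace ℝ (Fin d)) R)),
      Tendsto (fun j => v j y) atTop (𝓝 (v₀ y))) :
    (∃ Dv₀, GenOrlicz.IsW11Gradient (Metric.ball 0 R) v₀ Dv₀) ∧
    ∀ Dv₀, GenOrlicz.IsW11Gradient (Metric.ball 0 R) v₀ Dv₀ →
      ∫⁻ y in Metric.ball 0 R, ENNReal.ofReal (φinf ‖Dv₀ y‖) ≤
        liminf (fun j => ∫⁻ y in Metric.ball 0 R,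
          ENNReal.ofReal (GenOrlicz.rescale φ (r j) (σ j) y ‖Dv j y‖)) atTop := by

  have h2RΩ : Metric.ball (0 : EuclideanSpace ℝ (Fin d)) (2 * R) ⊆ Ω := subset_closure.trans hRΩ
  have hsub : Metric.ball (0 : EuclideanSpace ℝ (Fin d)) R ⊆ Metric.ball 0 (2 * R) :=
    Metric.ball_subset_ball (by linarith)
  have h0B : (0 : EuclideanSpace ℝ (Fin d)) ∈ Metric.ball 0 (2 * R) :=
    Metric.mem_ball_self (by linarith)
  have h0Ω : (0 : EuclideanSpace ℝ (Fin d)) ∈ Ω := h2RΩ h0B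
  -- The limit does not depend on `x`, so its properties can be read off at the origin, where the
  -- normalization is made.
  obtain ⟨hcvx, hmono, hzero, hone⟩ := GenOrlicz.limit_rescale_props (r := r) (φinf := φinf)
    (hφ.isConvexPhi 0 h0Ω) hσ hσ_top fun t ht =>
      (hconv {t} isCompact_singleton (by simpa using ht)).tendsto_at (x := (0, t)) ⟨h0B, rfl⟩
  have hunif : ∀ᶠ j in atTop, ∀ y ∈ Metric.ball (0 : EuclideanSpace ℝ (Fin d)) R,
      1 / 2 ≤ GenOrlicz.rescale φ (r j) (σ j) y 1 := by
    filter_upwards [Metric.tendstoUniformlyOn_iff.1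
      (hconv {1} isCompact_singleton (by simp)) (1 / 2) (by norm_num)] with j hj y hy
    have h := hj (y, 1) ⟨hsub hy, rfl⟩
    rw [Real.dist_eq, abs_lt] at h
    simp only [hone] at h
    linarith [h.2]
  have hgrowth := GenOrlicz.eventually_rpow_le_rescale hφ hφ1 hinc h0Ω (hsub.trans h2RΩ) hr hσ hr0
    hunif
  have hK : volume.restrict (Metric.ball (0 : EuclideanSpace ℝ (Fin d)) R) univ +
      2 * ENNReal.ofReal C ≠ ⊤ := by
    refine ENNReal.add_ne_top.2 ⟨?_, ENNReal.mul_ne_top (by simp) ENNReal.ofReal_ne_top⟩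
    simpa using measure_ball_lt_top.ne
  have hbd : ∀ᶠ j in atTop, ∫⁻ x in Metric.ball 0 R, ‖Dv j x‖ₑ ^ p ≤
      volume.restrict (Metric.ball (0 : EuclideanSpace ℝ (Fin d)) R) univ +
        2 * ENNReal.ofReal C := by
    filter_upwards [hgrowth] with j hj
    exact GenOrlicz.lintegral_enorm_rpow_le (by linarith)
      ((ae_restrict_mem measurableSet_ball).mono fun y hy => hj y hy) (hbound j)
  refine ⟨?_, fun Dv₀ hDv₀ => ?_⟩
  · obtain ⟨g, hg, -⟩ := GenOrlicz.exists_weak_limit_gradient hR hv hp hK hbd hv₀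
      (Ultrafilter.of atTop) (Ultrafilter.of_le _)
    exact ⟨g, hg⟩
  -- Only the values of `φinf` on `[0, ∞)` are controlled; extending by the constant `φinf 0` gives
  -- a convex nondecreasing function on the line, with the same values at norms.
  · have hmono' : Monotone fun t => φinf (max t 0) := fun s t hst =>
      hmono (mem_Ici.2 (le_max_right _ _)) (mem_Ici.2 (le_max_right _ _)) (max_le_max_right 0 hst)
    have h := GenOrlicz.lintegral_le_liminf_of_tendsto hR hv hp hK hbd hv₀
      (Φ := fun j => GenOrlicz.rescale φ (r j) (σ j)) (GenOrlicz.convexOn_comp_max_zero hcvx hmono)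
      hmono' (fun t => ?_) hgrowth (fun S hS hS0 => ?_) hDv₀
    · simpa only [max_eq_left (norm_nonneg _)] using h
    · exact hzero.symm.le.trans
        (hmono (mem_Ici.2 le_rfl) (mem_Ici.2 (le_max_right _ _)) (le_max_right _ _))
    · refine ((hconv S hS hS0).mono (prod_mono hsub Subset.rfl)).congr_right fun z hz => ?_
      simp only [max_eq_left (show 0 ≤ z.2 from hS0 hz.2)]
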